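/- **Conventions.** A Weyl space $(M,c,D)$ is a smooth manifold $M$ endowed with a conformal structure $c$ (a conformal class of Riemannian metrics) and a smooth torsion-free connection $D$ on $TM$ which preserves $c$. If $(M,c,D)$ is oriented and even-dimensional, let $\pi_M:Q_M\to M$ be the bundle of positive maximal isotropic spaces on $(M,c)$, that is, of the $(-\mathrm i)$-eigenspaces in $T^{\mathbb C}M$ of the positive orthogonal complex structures on $(M,c)$; its fibres are complex submanifolds of Grassmannians. Let $\mathscr H\subseteq TQ_M$ be the connection induced by $D$, let $\mathscr G_0\subseteq\mathscr H^{\mathbb C}$ be the subbundle with $\mathrm d\pi_M(\mathscr G_{0,q})=q$ for any $q\in Q_M$, and let $\mathcal J'_M$ be the almost complex structure on $Q_M$ whose eigenbundle corresponding to $-\mathrm i$ is $\mathscr G'=\mathscr G_0\oplus(\ker\mathrm d\pi_M)^{1,0}$. Then $\tau'_M=(Q_M,M,\pi_M,\mathcal J'_M)$ is the nonintegrable almost twistorial structure associated to $(M,c,D)$. If $p$ is a section of $Q_M$ then $J^p$ denotes the almost Hermitian structure on $(M,c)$ whose $(-\mathrm i)$-eigenbundle is $p$. A map between manifolds with almost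 complex structures is holomorphic if its complexified differential maps the $(-\mathrm i)$-eigenbundle into the $(-\mathrm i)$-eigenbundle. All sections and maps are smooth. **Setting.** Let $(M,c_M,D^M)$ and $(N,c_N,D^N)$ be even-dimensional oriented Weyl spaces, with the associated nonintegrable almost twistorial structures $\tau'_M$ and $\tau'_N$, and let $\varphi:M\hookrightarrow N$ be an injective immersion. Denote by $(TM)^\perp\subseteq\varphi^*TN$ its normal bundle with respect to $c_N$, oriented such that $\varphi^*TN=TM\oplus(TM)^\perp$ preserves the orientations, by $\Pi:\varphi^*TN\to(TM)^\perp$ the orthogonal projection, and by $\pi:Q\to M$ the bundle of positive maximal isotropic spaces on $\bigl((TM)^\perp,c_N|_{(TM)^\perp}\bigr)$. For a section $p$ of $Q_M$ let $\mathcal J^p$ be the almost complex structure on $Q$ whose eigenbundle corresponding to $-\mathrm i$ is the direct sum of $(\ker\mathrm d\pi)^{1,0}$ and of the horizontal lift of $p\subseteq T^{\mathbb C}M$ with respect to the connection induced on $Q$ by the connection $\Pi\circ D^N$ on $(TM)^\perp$. Let $p$ be a section of $Q_M$ such that the spaces $\mathrm d\varphi(p_x)$, $x\in M$, are isotropic with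 respect to $c_N$, let $q$ be a section of $Q$, and let $\varPhi:p(M)\to Q_N$ be the map with $\varPhi\circ p=p\oplus q$; in particular, $\pi_N\circ\varPhi=\varphi\circ\pi_M|_{p(M)}$. The map $\varphi:(M,\tau'_M)\to(N,\tau'_N)$ is *twistorial with respect to* $\varPhi$ if the tangent bundle of $p(M)$ is preserved by $\mathcal J'_M$ and $\varPhi:\bigl(p(M),\mathcal J'_M|_{T(p(M))}\bigr)\to(Q_N,\mathcal J'_N)$ is holomorphic. **Proposition.** The following assertions are equivalent: (i) $\varphi:(M,\tau'_M)\to(N,\tau'_N)$ is twistorial with respect to $\varPhi$. (ii) $\varphi$ is $(1,1)$-geodesic with respect to $J^p$ (that is, the $(1,1)$-part with respect to $J^p$ of the second fundamental form $(D\,\mathrm d\varphi)(X,Y)=D^N_X(\mathrm d\varphi(Y))-\mathrm d\varphi(D^M_XY)$ is zero), $p:(M,J^p)\to(Q_M,\mathcal J'_M)$ is holomorphic, and $q:(M,J^p)\to(Q,\mathcal J^p)$ is holomorphic. -/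

import Mathlib

open scoped Manifold ContDiff Topology TensorProduct
open Bundle

noncomputable section

namespace Twistor

/-- The Euclidean space on which manifolds of dimension `d` are modelled. -/
abbrev Euc (d : ℕ) : Type := EuclideanSpace ℝ (Fin d)

/-! ### Linear algebra -/

section Linear

variable {V : Type*} [AddCommGroup V] [Module ℝ V]

/-- The eigenspace, in the complexification of `V`, of `J` corresponding to `-i`. If `J` is an
orthogonal complex structure then this is the maximal isotropic space corresponding to `J`; more
generally, if `J` is zero on some subspace of `V` and an orthogonal complex structure on its
orthogonal complement, then this is the corresponding maximal isotropic space of the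
complexification of that complement. -/
def antiholomorphicSpace (J : V →ₗ[ℝ] V) : Submodule ℂ (ℂ ⊗[ℝ] V) :=
  Module.End.eigenspace (J.baseChange ℂ) (-Complex.I)

/-- A real subspace `W` of `V` is preserved by the (almost) complex structure `𝒥` (on some subspace
of `V`) whose eigenspace corresponding to `-i` is `F`: the vectors of `F` are of the form
`v + i 𝒥 v`, so that `𝒥 v = w` if and only if `v + i w ∈ F`. -/
def IsPreserved (F : Submodule ℂ (ℂ ⊗[ℝ] V)) (W : Submodule ℝ V) : Prop :=
  ∀ v ∈ W, ∃ w ∈ W, (1 : ℂ) ⊗ₜ[ℝ] v + Complex.I ⊗ₜ[ℝ] w ∈ F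

/-- `J` is a complex structure on `V`, orthogonal with respect to the scalar product `g`, and
positive with respect to the orientation `o`: it induces `o`, that is, some basis of the form
`e₀, J e₀, e₁, J e₁, …` is positively oriented. -/
structure IsPositiveOrthogonal {d : ℕ} (g : LinearMap.BilinForm ℝ V) (o : Orientation ℝ V (Fin d))
    (J : V →ₗ[ℝ] V) : Prop where
  sq : ∀ v, J (J v) = -v
  orthogonal : ∀ v w, g (J v) (J w) = g v w
  positive : ∃ b : Module.Basis (Fin d) ℝ V, b.orientation = o ∧
    ∀ (j : ℕ) (hj : 2 * j + 1 < d), b ⟨2 * j + 1, hj⟩ = J (b ⟨2 * j, by omega⟩)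

end Linear

/-! ### Weyl spaces -/

section Weyl

variable (d : ℕ) (B : Type*) [TopologicalSpace B] [ChartedSpace (Euc d) B]
  [IsManifold (𝓡 d) ∞ B]

/-- Smooth Riemannian metrics. -/
abbrev Metric : Type _ :=
  ContMDiffRiemannianMetric (𝓡 d) ∞ (Euc d) (fun x : B ↦ TangentSpace (𝓡 d) x)

/-- Connections on the tangent bundle. -/
abbrev Connection : Type _ :=
  CovariantDerivative (𝓡 d) (Euc d) (fun x : B ↦ TangentSpace (𝓡 d) x)

/-- Two metrics are conformal if each is a positive function times the other (this function is
necessarily smooth). -/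
def conformalSetoid : Setoid (Metric d B) where
  r g h := ∃ f : B → ℝ, (∀ x, 0 < f x) ∧
    ∀ (x : B) (v w : TangentSpace (𝓡 d) x), h.inner x v w = f x * g.inner x v w
  iseqv :=
    { refl := fun g ↦ ⟨fun _ ↦ 1, fun _ ↦ one_pos, fun x v w ↦ (one_mul _).symm⟩
      symm := by
        rintro g h ⟨f, hf, H⟩
        refine ⟨fun x ↦ (f x)⁻¹, fun x ↦ inv_pos.2 (hf x), fun x v w ↦ ?_⟩
        rw [H, inv_mul_cancel_left₀ (hf x).ne']
      trans := by
        rintro g h k ⟨f, hf, H⟩ ⟨f', hf', H'⟩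
        refine ⟨fun x ↦ f' x * f x, fun x ↦ mul_pos (hf' x) (hf x), fun x v w ↦ ?_⟩
        rw [H', H, mul_assoc] }

/-- A conformal structure: a conformal class of Riemannian metrics. -/
def ConformalStructure : Type _ := Quotient (conformalSetoid d B)

variable {d B}

/-- Some metric in the conformal class. All the notions defined below by means of it (orthogonal,
skew-symmetric, isotropic, Weyl connection) do not depend on the choice of that metric. -/
def ConformalStructure.metric (c : ConformalStructure d B) : Metric d B :=
  @Quotient.out _ (conformalSetoid d B) c

/-- The scalar product given, on a tangent space, by a metric in the conformal class. -/
def ConformalStructure.form (c : ConformalStructure d B) (x : B) :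
    LinearMap.BilinForm ℝ (TangentSpace (𝓡 d) x) :=
  LinearMap.mk₂ ℝ (fun v w ↦ c.metric.inner x v w)
    (fun _ _ _ ↦ by simp) (fun _ _ _ ↦ by simp) (fun _ _ _ ↦ by simp) (fun _ _ _ ↦ by simp)

/-- `Y` is a vector field which is smooth at `x`. -/
def SmoothFieldAt (Y : Π x : B, TangentSpace (𝓡 d) x) (x : B) : Prop :=
  ContMDiffAt (𝓡 d) (𝓡 d).tangent ∞ (fun y ↦ (⟨y, Y y⟩ : TangentBundle (𝓡 d) B)) x

/-- A Weyl connection: a smooth torsion free connection which preserves the conformal structure,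
that is, `D g = α ⊗ g` for some one-form `α`, where `g` is a metric in the conformal class. -/
structure IsWeylConnection (c : ConformalStructure d B) (D : Connection d B) : Prop where
  smooth : D.ContMDiffCovariantDerivative ∞
  torsion_eq_zero : D.torsion = 0
  conformal : ∃ α : Π x : B, TangentSpace (𝓡 d) x →L[ℝ] ℝ,
    ∀ (x : B) (X : TangentSpace (𝓡 d) x) (Y Z : Π y : B, TangentSpace (𝓡 d) y),
      SmoothFieldAt Y x → SmoothFieldAt Z x →
      mvfderiv (𝓡 d) (fun y ↦ c.form y (Y y) (Z y)) x X =
        c.form x (D Y x X) (Z x) + c.form x (Y x) (D Z x X) + α x X * c.form x (Y x) (Z x)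

/-- The orientations of the tangent spaces vary continuously: near each point there is a local
frame, formed of smooth vector fields, which is positively oriented. -/
def IsManifoldOrientation (o : Π x : B, Orientation ℝ (TangentSpace (𝓡 d) x) (Fin d)) : Prop :=
  ∀ x₀ : B, ∃ X : Fin d → Π x : B, TangentSpace (𝓡 d) x, (∀ i, SmoothFieldAt (X i) x₀) ∧
    ∀ᶠ x in 𝓝 x₀, ∃ b : Module.Basis (Fin d) ℝ (TangentSpace (𝓡 d) x),
      (∀ i, b i = X i x) ∧ b.orientation = o x

variable (d B) in
/-- The structure of an oriented Weyl space `(B, c, D)` of dimension `d`. -/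
structure OrientedWeyl where
  c : ConformalStructure d B
  D : Connection d B
  isWeyl : IsWeylConnection c D
  o : Π x : B, Orientation ℝ (TangentSpace (𝓡 d) x) (Fin d)
  isOrientation : IsManifoldOrientation o

end Weyl

/-! ### The bundle of positive maximal isotropic spaces

A positive maximal isotropic space is represented by the positive orthogonal complex structure whose
eigenspace corresponding to `-i` it is. So the bundle of positive maximal isotropic spaces is a
submanifold of the total space of the bundle of endomorphisms of the tangent bundle. -/

section TwistorBundle

/-- Endomorphisms of the tangent space at a point. -/
abbrev EndAt (d : ℕ) {B : Type*} [TopologicalSpace B] [ChartedSpace (Euc d) B] (x : B) : Type _ :=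
  TangentSpace (𝓡 d) x →L[ℝ] TangentSpace (𝓡 d) x

/-- The total space of the bundle of endomorphisms of the tangent bundle. -/
abbrev EndBundle (d : ℕ) (B : Type*) [TopologicalSpace B] [ChartedSpace (Euc d) B]
    [IsManifold (𝓡 d) ∞ B] : Type _ :=
  TotalSpace (Euc d →L[ℝ] Euc d) (fun x : B ↦ EndAt d x)

/-- The model of the total space of the bundle of endomorphisms of the tangent bundle. -/
abbrev endModel (d : ℕ) :
    ModelWithCorners ℝ (Euc d × (Euc d →L[ℝ] Euc d)) (ModelProd (Euc d) (Euc d →L[ℝ] Euc d)) :=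
  (𝓡 d).prod 𝓘(ℝ, Euc d →L[ℝ] Euc d)

variable {d : ℕ} {B : Type*} [TopologicalSpace B] [ChartedSpace (Euc d) B]
  [IsManifold (𝓡 d) ∞ B]

/-- The bundle of positive maximal isotropic spaces. -/
def OrientedWeyl.twistorBundle (W : OrientedWeyl d B) : Set (EndBundle d B) :=
  {e | IsPositiveOrthogonal (W.c.form e.proj) (W.o e.proj) (e.snd : EndAt d e.proj).toLinearMap}

/-- `A` is tangent at `J` to the fibre of the bundle of positive maximal isotropic spaces: it
anticommutes with `J` and it is skew-symmetric. -/
def OrientedWeyl.IsFibreTangent (W : OrientedWeyl d B) (x : B) (J A : EndAt d x) : Prop :=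
  (∀ v, A (J v) = -J (A v)) ∧ ∀ v w, W.c.form x (A v) w = -W.c.form x v (A w)

/-- The vertical tangent vector, at `J`, of the bundle of endomorphisms, given by `A`: the velocity
of `t ↦ J + t A` at `t = 0`. -/
def verticalLift (x : B) (J A : EndAt d x) :
    TangentSpace (endModel d) (⟨x, J⟩ : EndBundle d B) :=
  mfderiv 𝓘(ℝ, ℝ) (endModel d) (fun t : ℝ ↦ (⟨x, J + t • A⟩ : EndBundle d B)) 0 (1 : ℝ)

/-- The horizontal space, at `J`, of the connection induced by `D` on the bundle of endomorphisms:
it is formed of the vectors `dS(X)`, where `S` is a local section through `J` with `D_X S = 0`,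
that is, `D_X (S Y) = S (D_X Y)` for any vector field `Y`. At the points of the bundle of positive
maximal isotropic spaces, this is the horizontal space of the connection induced by `D` on it. -/
def horizontalSpace (D : Connection d B) (x : B) (J : EndAt d x) :
    Submodule ℝ (TangentSpace (endModel d) (⟨x, J⟩ : EndBundle d B)) :=
  Submodule.span ℝ {v | ∃ (S : Π y : B, EndAt d y) (X : TangentSpace (𝓡 d) x), S x = J ∧
    ContMDiffAt (𝓡 d) (endModel d) ∞ (fun y ↦ (⟨y, S y⟩ : EndBundle d B)) x ∧
    (∀ Y : Π y : B, TangentSpace (𝓡 d) y, SmoothFieldAt Y x →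
      D (fun y ↦ S y (Y y)) x X = J (D Y x X)) ∧
    v = mfderiv (𝓡 d) (endModel d) (fun y ↦ (⟨y, S y⟩ : EndBundle d B)) x X}

/-- The differential of the projection from the bundle of endomorphisms to the base. -/
def dProj (x : B) (J : EndAt d x) :
    TangentSpace (endModel d) (⟨x, J⟩ : EndBundle d B) →L[ℝ] TangentSpace (𝓡 d) x :=
  mfderiv (endModel d) (𝓡 d) (fun e : EndBundle d B ↦ e.proj) ⟨x, J⟩

/-- The complexification of the space of vertical vectors tangent to the bundle of positive maximal
isotropic spaces has a `(1,0)`-part, formed of the vectors `A - i J A`: as a complex submanifold of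
a Grassmannian, the fibre has at `J` the complex structure `A ↦ J ∘ A` (the map which `A` induces
from the `(-i)`-eigenspace `q` of `J` to the quotient of the complexified tangent space through `q`
gets multiplied by `i`). -/
def OrientedWeyl.verticalHolomorphic (W : OrientedWeyl d B) (x : B) (J : EndAt d x) :
    Submodule ℂ (ℂ ⊗[ℝ] TangentSpace (endModel d) (⟨x, J⟩ : EndBundle d B)) :=
  Submodule.span ℂ {Z | ∃ A : EndAt d x, W.IsFibreTangent x J A ∧
    Z = (1 : ℂ) ⊗ₜ[ℝ] verticalLift x J A - Complex.I ⊗ₜ[ℝ] verticalLift x J (J.comp A)}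

/-- The complex distribution `𝒢' = 𝒢₀ ⊕ (ker dπ)^{1,0}` on the bundle of positive maximal isotropic
spaces, where `𝒢₀` is horizontal and projects, at each `q`, onto `q`. It is the eigenbundle,
corresponding to `-i`, of the almost complex structure `𝒥'` of the nonintegrable almost twistorial
structure associated to a Weyl space. -/
def OrientedWeyl.distribution (W : OrientedWeyl d B) (e : EndBundle d B) :
    Submodule ℂ (ℂ ⊗[ℝ] TangentSpace (endModel d) e) :=
  ((horizontalSpace W.D e.proj e.snd).baseChange ℂ ⊓
    (antiholomorphicSpace (e.snd : EndAt d e.proj).toLinearMap).comap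
      ((dProj e.proj e.snd).toLinearMap.baseChange ℂ)) ⊔
  W.verticalHolomorphic e.proj e.snd

/-- The section of the bundle of endomorphisms corresponding to a family of endomorphisms. -/
def section_ (p : Π x : B, EndAt d x) (x : B) : EndBundle d B := ⟨x, p x⟩

/-- `p` is a (smooth) section of the bundle of positive maximal isotropic spaces. As an endomorphism
of the tangent bundle, it is the almost Hermitian structure `J^p`. -/
structure OrientedWeyl.IsSection (W : OrientedWeyl d B) (p : Π x : B, EndAt d x) : Prop where
  smooth : ContMDiff (𝓡 d) (endModel d) ∞ (section_ p)
  mem : ∀ x, section_ p x ∈ W.twistorBundle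

/-- `p : (B, J^p) → (Q, 𝒥')` is holomorphic. -/
def OrientedWeyl.IsHolomorphicSection (W : OrientedWeyl d B) (p : Π x : B, EndAt d x) : Prop :=
  ∀ x, (antiholomorphicSpace (p x).toLinearMap).map
    ((mfderiv (𝓡 d) (endModel d) (section_ p) x).toLinearMap.baseChange ℂ) ≤
      W.distribution (section_ p x)

end TwistorBundle

/-! ### Immersions -/

section Immersion

variable {m n : ℕ}
  {M : Type*} [TopologicalSpace M] [ChartedSpace (Euc m) M] [IsManifold (𝓡 m) ∞ M]
  {N : Type*} [TopologicalSpace N] [ChartedSpace (Euc n) N] [IsManifold (𝓡 n) ∞ N]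

/-- The differential of a map. -/
abbrev differential (φ : M → N) (x : M) : TangentSpace (𝓡 m) x →L[ℝ] TangentSpace (𝓡 n) (φ x) :=
  mfderiv (𝓡 m) (𝓡 n) φ x

/-- A smooth injective immersion. -/
structure IsInjectiveImmersion (φ : M → N) : Prop where
  smooth : ContMDiff (𝓡 m) (𝓡 n) ∞ φ
  injective : Function.Injective φ
  immersion : ∀ x, Function.Injective (differential (m := m) (n := n) φ x)

/-- The pull back by `φ` of the connection `D`, applied to a section `s` of the pull back by `φ` of
the tangent bundle: if, with respect to a local frame `(e_i)` of the tangent bundle (given by a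
trivialization), we have `s = ∑ s_i (e_i ∘ φ)`, then
`D_X s = ∑ (X(s_i) (e_i ∘ φ) + s_i D_{dφ(X)} e_i)`. -/
def pullbackConnection (D : Connection n N) (φ : M → N) (s : Π x : M, TangentSpace (𝓡 n) (φ x))
    (x : M) : TangentSpace (𝓡 m) x →L[ℝ] TangentSpace (𝓡 n) (φ x) :=
  letI e := trivializationAt (Euc n) (fun y : N ↦ TangentSpace (𝓡 n) y) (φ x)
  (e.symmL ℝ (φ x)).comp
      (mvfderiv (𝓡 m) (fun x' ↦ (e (⟨φ x', s x'⟩ : TangentBundle (𝓡 n) N)).2) x) +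
    (D (FiberBundle.extend (Euc n) (s x)) (φ x)).comp (differential φ x)

/-- The second fundamental form `(D dφ)(X, Y) = D^N_X (dφ(Y)) - dφ(D^M_X Y)` of `φ`, where the
tangent vector `Y` has been extended to a local vector field. -/
def secondFundamentalForm (DM : Connection m M) (DN : Connection n N) (φ : M → N) (x : M)
    (X Y : TangentSpace (𝓡 m) x) : TangentSpace (𝓡 n) (φ x) :=
  pullbackConnection DN φ (fun x' ↦ differential φ x' (FiberBundle.extend (Euc m) Y x')) x X -
    differential φ x (DM (FiberBundle.extend (Euc m) Y) x X)

/-- `φ` is `(1,1)`-geodesic with respect to `J`: the `(1,1)`-part of the second fundamental form is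
zero. -/
def IsOneOneGeodesic (DM : Connection m M) (DN : Connection n N) (φ : M → N)
    (J : Π x : M, EndAt m x) : Prop :=
  ∀ (x : M) (X Y : TangentSpace (𝓡 m) x), secondFundamentalForm DM DN φ x X Y +
    secondFundamentalForm DM DN φ x (J x X) (J x Y) = 0

/-- `p` is isotropic with respect to the conformal structure on the codomain of `φ`. -/
def IsIsotropicAlong (cN : ConformalStructure n N) (φ : M → N) (p : Π x : M, EndAt m x) : Prop :=
  ∀ x, ∀ Z ∈ antiholomorphicSpace (p x).toLinearMap, ∀ Z' ∈ antiholomorphicSpace (p x).toLinearMap,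
    (cN.form (φ x)).baseChange ℂ ((differential φ x).toLinearMap.baseChange ℂ Z)
      ((differential φ x).toLinearMap.baseChange ℂ Z') = 0

/-- The normal space at a point of the domain of `φ`. -/
def normalSpace (cN : ConformalStructure n N) (φ : M → N) (x : M) :
    Submodule ℝ (TangentSpace (𝓡 n) (φ x)) where
  carrier := {U | ∀ X : TangentSpace (𝓡 m) x, cN.form (φ x) U (differential φ x X) = 0}
  add_mem' hU hV X := by simp [hU X, hV X]
  zero_mem' X := by simp
  smul_mem' a U hU X := by simp [hU X]

/-- An endomorphism of the normal space, extended by zero to the tangent space of `M`. -/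
structure IsNormalEnd (cN : ConformalStructure n N) (φ : M → N) (x : M)
    (A : EndAt n (φ x)) : Prop where
  tangent : ∀ X : TangentSpace (𝓡 m) x, A (differential φ x X) = 0
  normal : ∀ U ∈ normalSpace (m := m) cN φ x, A U ∈ normalSpace (m := m) cN φ x

/-- The family of maps `q` is a section along `φ` of the bundle of endomorphisms of the tangent
bundle of the codomain. -/
def alongSection (φ : M → N) (q : Π x : M, EndAt n (φ x)) (x : M) : M × EndBundle n N :=
  (x, ⟨φ x, q x⟩)

/-- The positive maximal isotropic spaces on the normal space at `x`, represented by the positive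
orthogonal complex structures `K` on the normal space, extended by zero. Here, the normal space
is oriented such that its direct sum with the tangent space `T_x M` has the orientation of the
codomain: `e₁, …, e_m, U₀, K U₀, U₁, K U₁, …` is a positive frame on the codomain, for some positive
frame `e₁, …, e_m` on `M` and some normal vectors `U₀, U₁, …`. -/
structure IsNormalTwistor (WM : OrientedWeyl m M) (WN : OrientedWeyl n N) (φ : M → N) (x : M)
    (K : EndAt n (φ x)) : Prop where
  normalEnd : IsNormalEnd (m := m) WN.c φ x K
  sq : ∀ U ∈ normalSpace (m := m) WN.c φ x, K (K U) = -U
  orthogonal : ∀ U ∈ normalSpace (m := m) WN.c φ x, ∀ V ∈ normalSpace (m := m) WN.c φ x,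
    WN.c.form (φ x) (K U) (K V) = WN.c.form (φ x) U V
  positive : ∃ (e : Module.Basis (Fin m) ℝ (TangentSpace (𝓡 m) x))
    (b : Module.Basis (Fin n) ℝ (TangentSpace (𝓡 n) (φ x))),
    e.orientation = WM.o x ∧ b.orientation = WN.o (φ x) ∧
    (∀ (i : Fin m) (hi : i.val < n), b ⟨i, hi⟩ = differential φ x (e i)) ∧
    ∀ (j : ℕ) (hj : m + 2 * j + 1 < n), b ⟨m + 2 * j, by omega⟩ ∈ normalSpace (m := m) WN.c φ x ∧
      b ⟨m + 2 * j + 1, hj⟩ = K (b ⟨m + 2 * j, by omega⟩)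

/-- `q` is a (smooth) section of the bundle `Q` of positive maximal isotropic spaces on the normal
bundle of `φ`. This bundle is formed of the pairs `(x, K)`, with `x ∈ M` and `K` as above, and it is
a submanifold of the product of `M` with the total space of the bundle of endomorphisms of the
tangent bundle of the codomain. -/
structure IsNormalSection (WM : OrientedWeyl m M) (WN : OrientedWeyl n N) (φ : M → N)
    (q : Π x : M, EndAt n (φ x)) : Prop where
  smooth : ContMDiff (𝓡 m) ((𝓡 m).prod (endModel n)) ∞ (alongSection φ q)
  mem : ∀ x, IsNormalTwistor WM WN φ x (q x)

/-- `U` is a section of the normal bundle, smooth at `x`. -/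
def SmoothNormalFieldAt (cN : ConformalStructure n N) (φ : M → N)
    (U : Π x : M, TangentSpace (𝓡 n) (φ x)) (x : M) : Prop :=
  ContMDiffAt (𝓡 m) (𝓡 n).tangent ∞ (fun y ↦ (⟨φ y, U y⟩ : TangentBundle (𝓡 n) N)) x ∧
    ∀ᶠ y in 𝓝 x, U y ∈ normalSpace (m := m) cN φ y

/-- The horizontal space, at `(x, K)`, of the connection on `Q` induced by the connection `Π ∘ D` on
the normal bundle, where `Π` is the orthogonal projection onto the normal bundle: it is formed of
the vectors `dS(X)`, where `S` is a local section through `K` of the bundle of endomorphisms of the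
normal bundle such that `(Π ∘ D)_X S = 0`, that is, `Π (D_X (S U)) = S (Π (D_X U))` for any section
`U` of the normal bundle. As `K = K ∘ Π` takes values in the normal space, the latter condition means
that `D_X (S U) - K (D_X U)` is tangent to `M`. -/
def normalHorizontalSpace (cN : ConformalStructure n N) (D : Connection n N) (φ : M → N) (x : M)
    (K : EndAt n (φ x)) :
    Submodule ℝ (TangentSpace ((𝓡 m).prod (endModel n)) ((x, ⟨φ x, K⟩) : M × EndBundle n N)) :=
  Submodule.span ℝ {v | ∃ (S : Π y : M, EndAt n (φ y)) (X : TangentSpace (𝓡 m) x), S x = K ∧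
    ContMDiffAt (𝓡 m) ((𝓡 m).prod (endModel n)) ∞ (alongSection φ S) x ∧
    (∀ᶠ y in 𝓝 x, IsNormalEnd (m := m) cN φ y (S y)) ∧
    (∀ U : Π y : M, TangentSpace (𝓡 n) (φ y), SmoothNormalFieldAt (m := m) cN φ U x →
      pullbackConnection (m := m) D φ (fun y ↦ S y (U y)) x X -
          K (pullbackConnection (m := m) D φ U x X) ∈
        (differential (m := m) φ x).toLinearMap.range) ∧
    v = mfderiv (𝓡 m) ((𝓡 m).prod (endModel n)) (alongSection φ S) x X}

/-- The differential of the projection onto `M`. -/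
def normalDProj (φ : M → N) (x : M) (K : EndAt n (φ x)) :
    TangentSpace ((𝓡 m).prod (endModel n)) ((x, ⟨φ x, K⟩) : M × EndBundle n N) →L[ℝ]
      TangentSpace (𝓡 m) x :=
  mfderiv ((𝓡 m).prod (endModel n)) (𝓡 m) (fun z : M × EndBundle n N ↦ z.1) (x, ⟨φ x, K⟩)

/-- The vertical tangent vector, at `(x, K)`, given by `A`: the velocity of `t ↦ (x, K + t A)` at
`t = 0`. -/
def normalVerticalLift (φ : M → N) (x : M) (K A : EndAt n (φ x)) :
    TangentSpace ((𝓡 m).prod (endModel n)) ((x, ⟨φ x, K⟩) : M × EndBundle n N) :=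
  mfderiv 𝓘(ℝ, ℝ) ((𝓡 m).prod (endModel n))
    (fun t : ℝ ↦ ((x, ⟨φ x, K + t • A⟩) : M × EndBundle n N)) 0 (1 : ℝ)

/-- `A` is tangent at `K` to the fibre of `Q`: it is an endomorphism of the normal space,
it anticommutes with `K` and it is skew-symmetric. -/
structure IsNormalFibreTangent (cN : ConformalStructure n N) (φ : M → N) (x : M)
    (K A : EndAt n (φ x)) : Prop where
  normalEnd : IsNormalEnd (m := m) cN φ x A
  anticommutes : ∀ U ∈ normalSpace (m := m) cN φ x, A (K U) = -K (A U)
  skew : ∀ U ∈ normalSpace (m := m) cN φ x, ∀ V ∈ normalSpace (m := m) cN φ x,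
    cN.form (φ x) (A U) V = -cN.form (φ x) U (A V)

/-- The eigenspace, corresponding to `-i`, at `(x, K)`, of the almost complex structure `𝒥^p` on `Q`:
the sum of the horizontal lift of `p` and of the `(1,0)`-part `(ker dπ)^{1,0}` of the space of
vertical vectors (equivalently, the eigenspace corresponding to `i` is the sum of the horizontal
lift of the conjugate of `p` and of `(ker dπ)^{0,1}`). -/
def normalDistribution (cN : ConformalStructure n N) (D : Connection n N) (φ : M → N)
    (p : Π x : M, EndAt m x) (x : M) (K : EndAt n (φ x)) :
    Submodule ℂ (ℂ ⊗[ℝ]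
      TangentSpace ((𝓡 m).prod (endModel n)) ((x, ⟨φ x, K⟩) : M × EndBundle n N)) :=
  ((normalHorizontalSpace cN D φ x K).baseChange ℂ ⊓
    (antiholomorphicSpace (p x).toLinearMap).comap
      ((normalDProj (m := m) φ x K).toLinearMap.baseChange ℂ)) ⊔
  Submodule.span ℂ {Z | ∃ A : EndAt n (φ x), IsNormalFibreTangent (m := m) cN φ x K A ∧
    Z = (1 : ℂ) ⊗ₜ[ℝ] normalVerticalLift (m := m) φ x K A -
      Complex.I ⊗ₜ[ℝ] normalVerticalLift (m := m) φ x K (K.comp A)}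

/-- `q : (M, J^p) → (Q, 𝒥^p)` is holomorphic. -/
def IsHolomorphicNormalSection (cN : ConformalStructure n N) (D : Connection n N) (φ : M → N)
    (p : Π x : M, EndAt m x) (q : Π x : M, EndAt n (φ x)) : Prop :=
  ∀ x, (antiholomorphicSpace (p x).toLinearMap).map
    ((mfderiv (𝓡 m) ((𝓡 m).prod (endModel n)) (alongSection φ q) x).toLinearMap.baseChange ℂ) ≤
      normalDistribution cN D φ p x (q x)

/-! ### Twistorial maps -/

/-- The map `Φ ∘ p`, from `M` to the bundle of endomorphisms of the tangent bundle of the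
codomain. -/
def compSection {p : Π x : M, EndAt m x} {QN : Set (EndBundle n N)}
    (Φ : Set.range (section_ p) → QN) (x : M) : EndBundle n N :=
  (Φ ⟨section_ p x, x, rfl⟩ : EndBundle n N)

/-- `Φ ∘ p = p ⊕ q`; in particular, `π_N ∘ Φ = φ ∘ π_M` on `p(M)`. -/
def IsGivenBy (φ : M → N) (p : Π x : M, EndAt m x) (q : Π x : M, EndAt n (φ x))
    {QN : Set (EndBundle n N)} (Φ : Set.range (section_ p) → QN) : Prop :=
  ∀ x, ∃ S : EndAt n (φ x), compSection Φ x = ⟨φ x, S⟩ ∧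
    antiholomorphicSpace S.toLinearMap =
      (antiholomorphicSpace (p x).toLinearMap).map
        ((differential φ x).toLinearMap.baseChange ℂ) ⊔
      antiholomorphicSpace (q x).toLinearMap

/-- A map from `M` to `N`, endowed with the nonintegrable almost twistorial structures, is twistorial
with respect to `Φ : p(M) → Q_N`: the tangent bundle of `p(M)` is preserved by `𝒥'_M`, and
`dΦ` maps the complex distribution, associated to the restriction of `𝒥'_M` to the tangent bundle of
`p(M)`, into the complex distribution associated to `𝒥'_N`. The tangent space of `p(M)` at `p(x)` is
the image of `dp`, and the differential of `Φ` is determined by `dΦ ∘ dp = d(Φ ∘ p)`. -/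
def IsTwistorial (WM : OrientedWeyl m M) (WN : OrientedWeyl n N) (p : Π x : M, EndAt m x)
    (Φ : Set.range (section_ p) → WN.twistorBundle) : Prop :=
  (∀ x, IsPreserved (WM.distribution (section_ p x))
    (mfderiv (𝓡 m) (endModel m) (section_ p) x).toLinearMap.range) ∧
  ∀ (x : M) (Z : ℂ ⊗[ℝ] TangentSpace (𝓡 m) x),
    (mfderiv (𝓡 m) (endModel m) (section_ p) x).toLinearMap.baseChange ℂ Z ∈
      WM.distribution (section_ p x) →
    (mfderiv (𝓡 m) (endModel n) (compSection Φ) x).toLinearMap.baseChange ℂ Z ∈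
      WN.distribution (compSection Φ x)

end Immersion

end Twistor

end

open Twistor

/-! Let `J` be the structure `J^p`, and let `S` be the almost complex structure along `φ` given by
`Φ ∘ p`, so that `S ∘ dφ = dφ ∘ J` and `S = q` on normal vectors. Let `∇` be the covariant
derivative induced on endomorphisms, `B` the second fundamental form and `g` a metric in the
conformal class on `N`. The horizontal space is the kernel of the connector, the linear map which
sends the velocity `dS(X)` to `∇_X S` (`horizontalSpace_eq_ker`). As the `(-i)`-eigenspace contains
the vertical vectors `A - i S A`, the nonintegrable structure acts on vertical vectors as `A ↦ -S
A`. Hence `dS(X) + i dS(X')` lies in the eigenbundle if and only if `dφ(X') = S dφ(X)` and `∇_{X'} S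
= -S ∇_X S` (`cplx_mfderiv_mem_distribution_iff`). It follows that (i) amounts to the holomorphicity
of `p`, that is `∇_{JX} J = -J ∇_X J`, together with `∇_{JX} S = -S ∇_X S` (`isTwistorial_iff`). The
last equation is tested separately on tangent and on normal vectors. On tangent vectors, `(∇_X S)(dφ
Y) = B(X, JY) - S B(X, Y) + dφ((∇_X J) Y)`. If `p` is holomorphic, the condition becomes `B(X, Y) +
B(JX, JY) = S (B(JX, Y) - B(X, JY))`. Both connections are torsion-free, so `B` is symmetric; the
left side is then symmetric in `X, Y` and the right side antisymmetric, so both vanish, and the left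
side is twice the `(1,1)`-part (`isOneOneGeodesic_iff`). On normal vectors, `∇_X S` is skew because
the connection preserves the conformal structure, so the tangential component of the condition
follows from the condition on tangent vectors (`IsSum.eq_neg_comp`). The normal component of `∇_X S`
is that of the derivative of `q`, so what remains is the holomorphicity of `q`
(`isHolomorphicNormalSection_iff`). -/

noncomputable section

namespace Twistor

/-! ### Coordinates of tangent vectors and endomorphisms in the preferred frames -/

section Local

variable {d : ℕ} {B : Type*} [TopologicalSpace B] [ChartedSpace (Euc d) B]
  [IsManifold (𝓡 d) ∞ B]

variable (d) in
/-- The preferred local trivialization of the tangent bundle near `z`. -/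
abbrev frame (z : B) : Trivialization (Euc d) (TotalSpace.proj : TangentBundle (𝓡 d) B → B) :=
  trivializationAt (Euc d) (fun y : B ↦ TangentSpace (𝓡 d) y) z

variable (d) in
lemma mem_frame_baseSet (z : B) : z ∈ (frame d z).baseSet :=
  FiberBundle.mem_baseSet_trivializationAt' z

variable (d) in
lemma frame_baseSet_mem_nhds (z : B) : (frame d z).baseSet ∈ 𝓝 z :=
  (frame d z).open_baseSet.mem_nhds (mem_frame_baseSet d z)

/-- The coordinates, in the preferred frame near `z`, of tangent vectors at `y`. -/
def coordEquiv {z y : B} (hy : y ∈ (frame d z).baseSet) : TangentSpace (𝓡 d) y ≃L[ℝ] Euc d :=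
  (frame d z).continuousLinearEquivAt ℝ y hy

lemma frame_apply {z y : B} (hy : y ∈ (frame d z).baseSet) (v : TangentSpace (𝓡 d) y) :
    (frame d z (⟨y, v⟩ : TangentBundle (𝓡 d) B)).2 = coordEquiv hy v := by
  simp [coordEquiv]

lemma frame_symm_eq {z y : B} (hy : y ∈ (frame d z).baseSet) (w : Euc d) :
    (frame d z).symm y w = (coordEquiv hy).symm w := by
  rw [ContinuousLinearEquiv.eq_symm_apply, ← frame_apply,
    Trivialization.apply_mk_symm (frame d z) hy]

variable (d) in
/-- The coordinates of tangent vectors at `z`. -/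
def coordAt (z : B) : TangentSpace (𝓡 d) z ≃L[ℝ] Euc d :=
  coordEquiv (mem_frame_baseSet d z)

/-- The coordinates, near `z`, of endomorphisms of tangent spaces. -/
def endCoord (z : B) (e : EndBundle d B) : Euc d →L[ℝ] Euc d :=
  (trivializationAt (Euc d →L[ℝ] Euc d) (fun y : B ↦ EndAt d y) z e).2

lemma frame_symmL_self (z : B) (w : Euc d) :
    (frame d z).symmL ℝ z w = (coordAt d z).symm w := by
  rw [Trivialization.symmL_apply _ (mem_frame_baseSet d z), frame_symm_eq (mem_frame_baseSet d z)]
  rfl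

lemma endCoord_eq {z y : B} (hy : y ∈ (frame d z).baseSet) (A : EndAt d y) (w : Euc d) :
    endCoord z ⟨y, A⟩ w = coordEquiv hy (A ((coordEquiv hy).symm w)) := by
  rw [endCoord, hom_trivializationAt_apply]
  rw [ContinuousLinearMap.inCoordinates_eq hy hy]
  rfl

lemma endCoord_apply {z y : B} (hy : y ∈ (frame d z).baseSet) (A : EndAt d y)
    (v : TangentSpace (𝓡 d) y) :
    endCoord z ⟨y, A⟩ (coordEquiv hy v) = coordEquiv hy (A v) := by
  simp [endCoord_eq hy]

/-- The extension is built from the trivialization centred at `z`, so it has constant coordinates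
there. Evaluating connections and metrics on such fields isolates the Christoffel symbols. -/
lemma extend_coord_eventually (z : B) (v : TangentSpace (𝓡 d) z) :
    ∀ᶠ y in 𝓝 z, (frame d z (⟨y, FiberBundle.extend (Euc d) v y⟩ : TangentBundle (𝓡 d) B)).2 =
      coordAt d z v := by
  filter_upwards [frame_baseSet_mem_nhds d z] with y hy
  exact (congrArg Prod.snd (Trivialization.apply_mk_symm (frame d z) hy _)).trans
    (frame_apply (mem_frame_baseSet d z) v)

end Local

/-! ### Christoffel symbols and the pull-back connection in coordinates -/

section Pullback

variable {m n : ℕ}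
  {M : Type*} [TopologicalSpace M] [ChartedSpace (Euc m) M]
  {N : Type*} [TopologicalSpace N] [ChartedSpace (Euc n) N] [IsManifold (𝓡 n) ∞ N]

/-- The derivative of the coordinates of a section along `φ` of the tangent bundle. -/
def coordDerivative (φ : M → N) (s : Π x : M, TangentSpace (𝓡 n) (φ x)) (x : M) :
    TangentSpace (𝓡 m) x →L[ℝ] TangentSpace (𝓡 n) (φ x) :=
  ((coordAt n (φ x)).symm : Euc n →L[ℝ] TangentSpace (𝓡 n) (φ x)).comp
    (mvfderiv (𝓡 m) (fun x' ↦ (frame n (φ x) (⟨φ x', s x'⟩ : TangentBundle (𝓡 n) N)).2) x)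

/-- `s` is a section along `φ` of the tangent bundle, which is differentiable at `x`. -/
def DiffAlong (φ : M → N) (s : Π x : M, TangentSpace (𝓡 n) (φ x)) (x : M) : Prop :=
  MDifferentiableAt (𝓡 m) (𝓡 n).tangent (fun y ↦ (⟨φ y, s y⟩ : TangentBundle (𝓡 n) N)) x

lemma DiffAlong.coord {φ : M → N} {s : Π x : M, TangentSpace (𝓡 n) (φ x)} {x : M}
    (hs : DiffAlong (m := m) φ s x) :
    MDifferentiableAt (𝓡 m) 𝓘(ℝ, Euc n)
      (fun x' ↦ (frame n (φ x) (⟨φ x', s x'⟩ : TangentBundle (𝓡 n) N)).2) x :=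
  ((mdifferentiableAt_totalSpace (IB := 𝓡 n) _).1 hs).2

lemma DiffAlong.base {φ : M → N} {s : Π x : M, TangentSpace (𝓡 n) (φ x)} {x : M}
    (hs : DiffAlong (m := m) φ s x) : MDifferentiableAt (𝓡 m) (𝓡 n) φ x :=
  ((mdifferentiableAt_totalSpace (IB := 𝓡 n) _).1 hs).1

lemma eventually_mem_frame {φ : M → N} {x : M}
    (h : MDifferentiableAt (𝓡 m) (𝓡 n) φ x) : ∀ᶠ y in 𝓝 x, φ y ∈ (frame n (φ x)).baseSet :=
  h.continuousAt.eventually_mem (frame_baseSet_mem_nhds n (φ x))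

lemma mvfderiv_congr {E : Type*} [NormedAddCommGroup E] [NormedSpace ℝ E] {f g : M → E} {x : M}
    (h : f =ᶠ[𝓝 x] g) (X : TangentSpace (𝓡 m) x) :
    mvfderiv (𝓡 m) f x X = mvfderiv (𝓡 m) g x X := by
  have := h.mfderiv_eq (I := 𝓡 m) (I' := 𝓘(ℝ, E))
  exact congrArg (fun L : TangentSpace (𝓡 m) x →L[ℝ] E ↦ L X) this

lemma coordDerivative_congr {φ : M → N} {s t : Π x : M, TangentSpace (𝓡 n) (φ x)} {x : M}
    (h : ∀ᶠ y in 𝓝 x, s y = t y) :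
    coordDerivative (m := m) φ s x = coordDerivative φ t x := by
  ext v
  refine congrArg (coordAt n (φ x)).symm (mvfderiv_congr ?_ v)
  filter_upwards [h] with y hy
  rw [hy]

lemma coordDerivative_add {φ : M → N} {s t : Π x : M, TangentSpace (𝓡 n) (φ x)} {x : M}
    (hs : DiffAlong (m := m) φ s x) (ht : DiffAlong (m := m) φ t x) :
    coordDerivative (m := m) φ (s + t) x = coordDerivative φ s x + coordDerivative φ t x := by
  ext v
  have h : (fun x' ↦ (frame n (φ x) (⟨φ x', (s + t) x'⟩ : TangentBundle (𝓡 n) N)).2) =ᶠ[𝓝 x]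
      (fun x' ↦ (frame n (φ x) (⟨φ x', s x'⟩ : TangentBundle (𝓡 n) N)).2) +
      (fun x' ↦ (frame n (φ x) (⟨φ x', t x'⟩ : TangentBundle (𝓡 n) N)).2) := by
    filter_upwards [eventually_mem_frame hs.base] with y hy
    simp only [Pi.add_apply, frame_apply hy, map_add]
  have h2 := mvfderiv_congr h v
  rw [mvfderiv_add hs.coord ht.coord] at h2
  exact (congrArg (coordAt n (φ x)).symm h2).trans (map_add _ _ _)

lemma coordDerivative_smul {φ : M → N} {f : M → ℝ} {s : Π x : M, TangentSpace (𝓡 n) (φ x)} {x : M}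
    (hf : MDifferentiableAt (𝓡 m) 𝓘(ℝ, ℝ) f x) (hs : DiffAlong (m := m) φ s x) :
    coordDerivative (m := m) φ (f • s) x =
      f x • coordDerivative φ s x + (mvfderiv (𝓡 m) f x).smulRight (s x) := by
  ext v
  have h : (fun x' ↦ (frame n (φ x) (⟨φ x', (f • s) x'⟩ : TangentBundle (𝓡 n) N)).2) =ᶠ[𝓝 x]
      f • (fun x' ↦ (frame n (φ x) (⟨φ x', s x'⟩ : TangentBundle (𝓡 n) N)).2) := by
    filter_upwards [eventually_mem_frame hs.base] with y hy
    simp only [Pi.smul_apply', frame_apply hy, map_smul]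
  have h2 := mvfderiv_congr h v
  rw [mvfderiv_smul hf hs.coord] at h2
  refine (congrArg (coordAt n (φ x)).symm h2).trans ?_
  simp only [frame_apply (mem_frame_baseSet n (φ x)), _root_.add_apply,
    _root_.smul_apply, ContinuousLinearMap.smulRight_apply, map_add, map_smul]
  congr 2
  exact (coordAt n (φ x)).symm_apply_apply _

/-- Both operators satisfy the Leibniz rule with the same term `df ⊗ Y`, which cancels in the
difference. -/
lemma connection_sub_coordDerivative_tensorial (D : Connection n N) (z : N) :
    TensorialAt (𝓡 n) (Euc n)
      (fun Y : Π y : N, TangentSpace (𝓡 n) y ↦ D Y z - coordDerivative (m := n) (fun y ↦ y) Y z)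
      z where
  smul hf hY := by
    rw [D.isCovariantDerivativeOnUniv.leibniz hY hf, coordDerivative_smul hf hY]
    module
  add hY hY' := by
    rw [D.isCovariantDerivativeOnUniv.add hY hY', coordDerivative_add hY hY']
    module

/-- The Christoffel symbols of a connection, at the origin of the preferred frame. -/
def christoffel (D : Connection n N) (z : N) :
    TangentSpace (𝓡 n) z →L[ℝ] TangentSpace (𝓡 n) z →L[ℝ] TangentSpace (𝓡 n) z :=
  TensorialAt.mkHom _ z (connection_sub_coordDerivative_tensorial D z)

lemma connection_apply (D : Connection n N) {z : N} {Y : Π y : N, TangentSpace (𝓡 n) y}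
    (hY : DiffAlong (m := n) (fun y : N ↦ y) Y z) :
    D Y z = coordDerivative (m := n) (fun y ↦ y) Y z + christoffel D z (Y z) := by
  rw [christoffel, TensorialAt.mkHom_apply _ hY]
  abel

lemma coordDerivative_extend (z : N) (v : TangentSpace (𝓡 n) z) :
    coordDerivative (m := n) (fun y : N ↦ y) (FiberBundle.extend (Euc n) v) z = 0 := by
  ext X
  have h := mvfderiv_congr (m := n) (g := fun _ ↦ coordAt n z v) (extend_coord_eventually z v) X
  rw [mvfderiv_const] at h
  exact (congrArg (coordAt n z).symm h).trans (map_zero _)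

lemma connection_extend (D : Connection n N) (z : N) (v : TangentSpace (𝓡 n) z) :
    D (FiberBundle.extend (Euc n) v) z = christoffel D z v := by
  rw [connection_apply D (FiberBundle.mdifferentiableAt_extend ..), coordDerivative_extend,
    zero_add, FiberBundle.extend_apply_self]

/-- The second term of the definition is `D` applied to a field with constant coordinates, hence a
pure Christoffel term. So the pull-back connection is `d + Γ(dφ)`, whether or not `s` is
differentiable. -/
lemma pullbackConnection_eq (D : Connection n N) (φ : M → N)
    (s : Π x : M, TangentSpace (𝓡 n) (φ x)) (x : M) :
    pullbackConnection (m := m) D φ s x = coordDerivative φ s x +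
      (christoffel D (φ x) (s x)).comp (differential φ x) := by
  rw [pullbackConnection, connection_extend]
  congr 1
  ext v
  exact frame_symmL_self (φ x) _

end Pullback

/-! ### The connector of the bundle of endomorphisms -/

section Connector

variable {n : ℕ} {N : Type*} [TopologicalSpace N] [ChartedSpace (Euc n) N] [IsManifold (𝓡 n) ∞ N]

/-- The derivative, at `J`, of the coordinates of endomorphisms of the tangent bundle. -/
def endCoordDeriv (z : N) (J : EndAt n z) :
    TangentSpace (endModel n) (⟨z, J⟩ : EndBundle n N) →ₗ[ℝ] (Euc n →L[ℝ] Euc n) :=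
  (mvfderiv (endModel n) (endCoord z) (⟨z, J⟩ : EndBundle n N)).toLinearMap

/-- A linear endomorphism of a tangent space, as a continuous one. -/
def toEndAt {z : N} (L : TangentSpace (𝓡 n) z →ₗ[ℝ] TangentSpace (𝓡 n) z) : EndAt n z :=
  ⟨L, by
    let L' : Euc n →ₗ[ℝ] Euc n := L
    exact L'.continuous_of_finiteDimensional⟩

omit [IsManifold (𝓡 n) ∞ N] in
@[simp] lemma toEndAt_apply {z : N} (L : TangentSpace (𝓡 n) z →ₗ[ℝ] TangentSpace (𝓡 n) z)
    (v : TangentSpace (𝓡 n) z) : toEndAt L v = L v := rfl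

/-- The connector of the connection induced by `D` on the bundle of endomorphisms: it maps the
velocity of a section to the covariant derivative of that section. -/
def connector (D : Connection n N) (z : N) (J : EndAt n z) :
    TangentSpace (endModel n) (⟨z, J⟩ : EndBundle n N) →ₗ[ℝ] EndAt n z where
  toFun v := toEndAt
    -- With `Γ_X` the Christoffel endomorphism in the direction `X = dProj z J v`, this is `dJ +
    -- [Γ_X, J]`. The direction is the second vector argument of `christoffel`.
    { toFun := fun Y ↦ (coordAt n z).symm (endCoordDeriv z J v (coordAt n z Y)) +
        christoffel D z (J Y) (dProj z J v) - J (christoffel D z Y (dProj z J v))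
      map_add' := fun Y Y' ↦ by simp only [map_add, _root_.add_apply]; abel
      map_smul' := fun a Y ↦ by
        simp only [map_smul, _root_.smul_apply, RingHom.id_apply, smul_add, smul_sub] }
  map_add' v w := by
    have h1 := (dProj z J).map_add v w
    have h2 := (endCoordDeriv z J).map_add v w
    ext Y
    simp only [_root_.add_apply, toEndAt_apply, LinearMap.coe_mk, AddHom.coe_mk]
    rw [h1, h2]
    generalize dProj z J v = a, dProj z J w = b
    simp only [map_add, _root_.add_apply]
    abel
  map_smul' a v := by
    have h1 := (dProj z J).map_smul a v
    have h2 := (endCoordDeriv z J).map_smul a v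
    ext Y
    simp only [_root_.smul_apply, toEndAt_apply, LinearMap.coe_mk, AddHom.coe_mk,
      RingHom.id_apply]
    rw [h1, h2]
    generalize dProj z J v = b
    simp only [map_smul, _root_.smul_apply, smul_add, smul_sub]

lemma connector_apply (D : Connection n N) (z : N) (J : EndAt n z)
    (v : TangentSpace (endModel n) (⟨z, J⟩ : EndBundle n N)) (Y : TangentSpace (𝓡 n) z) :
    connector D z J v Y = (coordAt n z).symm (endCoordDeriv z J v (coordAt n z Y)) +
        christoffel D z (J Y) (dProj z J v) - J (christoffel D z Y (dProj z J v)) := rfl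

lemma mdifferentiableAt_endCoord (z : N) (J : EndAt n z) :
    MDifferentiableAt (endModel n) 𝓘(ℝ, Euc n →L[ℝ] Euc n) (endCoord z)
      (⟨z, J⟩ : EndBundle n N) :=
  ((mdifferentiableAt_totalSpace (IB := 𝓡 n) (fun e : EndBundle n N ↦ e)
    (x₀ := ⟨z, J⟩)).1 mdifferentiableAt_id).2

lemma mdifferentiableAt_proj (z : N) (J : EndAt n z) :
    MDifferentiableAt (endModel n) (𝓡 n) (fun e : EndBundle n N ↦ e.proj) ⟨z, J⟩ :=
  ((mdifferentiableAt_totalSpace (IB := 𝓡 n) (fun e : EndBundle n N ↦ e)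
    (x₀ := ⟨z, J⟩)).1 mdifferentiableAt_id).1

/-- A tangent vector to the bundle of endomorphisms is determined by its projection and by the
derivative of the coordinates. -/
lemma endBundle_tangent_ext {z : N} {J : EndAt n z}
    {v w : TangentSpace (endModel n) (⟨z, J⟩ : EndBundle n N)}
    (h1 : dProj z J v = dProj z J w) (h2 : endCoordDeriv z J v = endCoordDeriv z J w) : v = w := by
  let t := trivializationAt (Euc n →L[ℝ] Euc n) (fun y : N ↦ EndAt n y) z
  have hsrc : (⟨z, J⟩ : EndBundle n N) ∈ t.source := by
    rw [t.mem_source]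
    exact FiberBundle.mem_baseSet_trivializationAt' z
  have hg : MDifferentiableAt ((𝓡 n).prod 𝓘(ℝ, Euc n →L[ℝ] Euc n)) (endModel n)
      t.toOpenPartialHomeomorph.symm (t ⟨z, J⟩) :=
    ((t.contMDiffOn_symm (IB := 𝓡 n) (n := 1)).contMDiffAt
      (t.open_target.mem_nhds (t.map_source hsrc))).mdifferentiableAt one_ne_zero
  have ht : MDifferentiableAt (endModel n) ((𝓡 n).prod 𝓘(ℝ, Euc n →L[ℝ] Euc n)) t
      (⟨z, J⟩ : EndBundle n N) :=
    ((t.contMDiffOn (IB := 𝓡 n) (n := 1)).contMDiffAt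
      (t.open_source.mem_nhds hsrc)).mdifferentiableAt one_ne_zero
  have hcomp := mfderiv_comp (⟨z, J⟩ : EndBundle n N) hg ht
  -- The trivialization is a local diffeomorphism, so a vector is recovered from its image under
  -- `dt`, whose two components are the projection and the derivative of the coordinates.
  have hid : t.toOpenPartialHomeomorph.symm ∘ t =ᶠ[𝓝 (⟨z, J⟩ : EndBundle n N)] id := by
    filter_upwards [t.open_source.mem_nhds hsrc] with e he
    exact t.left_inv he
  rw [hid.mfderiv_eq, mfderiv_id] at hcomp
  have hprod : (t : EndBundle n N → _) =ᶠ[𝓝 (⟨z, J⟩ : EndBundle n N)]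
      fun e ↦ (e.proj, endCoord z e) := by
    filter_upwards [t.open_source.mem_nhds hsrc] with e he
    exact Prod.ext (t.coe_fst he) rfl
  have hd := hprod.mfderiv_eq (I := endModel n) (I' := (𝓡 n).prod 𝓘(ℝ, Euc n →L[ℝ] Euc n))
  rw [mfderiv_prodMk (mdifferentiableAt_proj z J) (mdifferentiableAt_endCoord z J)] at hd
  have key : ∀ u, u = (mfderiv ((𝓡 n).prod 𝓘(ℝ, Euc n →L[ℝ] Euc n)) (endModel n)
      t.toOpenPartialHomeomorph.symm (t ⟨z, J⟩)) ((mfderiv (endModel n)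
        ((𝓡 n).prod 𝓘(ℝ, Euc n →L[ℝ] Euc n)) t (⟨z, J⟩ : EndBundle n N)) u) :=
    fun u ↦ DFunLike.congr_fun hcomp u
  rw [key v, key w, hd]
  exact congrArg _ (Prod.ext h1 h2)

lemma dProj_mfderiv {m : ℕ} {M : Type*} [TopologicalSpace M] [ChartedSpace (Euc m) M] {φ : M → N}
    {S : Π x : M, EndAt n (φ x)} {x : M}
    (hS : MDifferentiableAt (𝓡 m) (endModel n) (fun y ↦ (⟨φ y, S y⟩ : EndBundle n N)) x)
    (X : TangentSpace (𝓡 m) x) :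
    dProj (φ x) (S x) (mfderiv (𝓡 m) (endModel n) (fun y ↦ (⟨φ y, S y⟩ : EndBundle n N)) x X) =
      differential φ x X :=
  (mfderiv_comp_apply (I := 𝓡 m) (I' := endModel n) (I'' := 𝓡 n)
    (g := fun e : EndBundle n N ↦ e.proj) x (mdifferentiableAt_proj (φ x) (S x)) hS X).symm

lemma endCoordDeriv_mfderiv {m : ℕ} {M : Type*} [TopologicalSpace M] [ChartedSpace (Euc m) M]
    {φ : M → N} {S : Π x : M, EndAt n (φ x)} {x : M}
    (hS : MDifferentiableAt (𝓡 m) (endModel n) (fun y ↦ (⟨φ y, S y⟩ : EndBundle n N)) x)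
    (X : TangentSpace (𝓡 m) x) :
    endCoordDeriv (φ x) (S x)
        (mfderiv (𝓡 m) (endModel n) (fun y ↦ (⟨φ y, S y⟩ : EndBundle n N)) x X) =
      mvfderiv (𝓡 m) (fun y ↦ endCoord (φ x) (⟨φ y, S y⟩ : EndBundle n N)) x X :=
  (mfderiv_comp_apply (I := 𝓡 m) (I' := endModel n) (I'' := 𝓘(ℝ, Euc n →L[ℝ] Euc n))
    (g := fun e : EndBundle n N ↦ endCoord (φ x) e) x
    (mdifferentiableAt_endCoord (φ x) (S x)) hS X).symm

end Connector

/-! ### Covariant derivatives of endomorphisms along a map, and the Leibniz rule -/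

section Leibniz

variable {m n : ℕ}
  {M : Type*} [TopologicalSpace M] [ChartedSpace (Euc m) M]
  {N : Type*} [TopologicalSpace N] [ChartedSpace (Euc n) N] [IsManifold (𝓡 n) ∞ N]

/-- `S` is a section along `φ` of the bundle of endomorphisms, which is differentiable at `x`. -/
def DiffEndAlong (φ : M → N) (S : Π x : M, EndAt n (φ x)) (x : M) : Prop :=
  MDifferentiableAt (𝓡 m) (endModel n) (fun y ↦ (⟨φ y, S y⟩ : EndBundle n N)) x

/-- The covariant derivative, with respect to the pull back by `φ` of `D`, of a section along `φ` of
the bundle of endomorphisms. -/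
def endDerivative (D : Connection n N) (φ : M → N) (S : Π x : M, EndAt n (φ x)) (x : M) :
    TangentSpace (𝓡 m) x →ₗ[ℝ] EndAt n (φ x) :=
  (connector D (φ x) (S x)).comp
    (mfderiv (𝓡 m) (endModel n) (fun y ↦ (⟨φ y, S y⟩ : EndBundle n N)) x).toLinearMap

lemma DiffEndAlong.base {φ : M → N} {S : Π x : M, EndAt n (φ x)} {x : M}
    (hS : DiffEndAlong (m := m) φ S x) : MDifferentiableAt (𝓡 m) (𝓡 n) φ x :=
  ((mdifferentiableAt_totalSpace (IB := 𝓡 n) _).1 hS).1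

lemma DiffEndAlong.coord {φ : M → N} {S : Π x : M, EndAt n (φ x)} {x : M}
    (hS : DiffEndAlong (m := m) φ S x) :
    MDifferentiableAt (𝓡 m) 𝓘(ℝ, Euc n →L[ℝ] Euc n)
      (fun y ↦ endCoord (φ x) (⟨φ y, S y⟩ : EndBundle n N)) x :=
  ((mdifferentiableAt_totalSpace (IB := 𝓡 n) _).1 hS).2

lemma DiffEndAlong.apply {φ : M → N} {S : Π x : M, EndAt n (φ x)}
    {s : Π x : M, TangentSpace (𝓡 n) (φ x)} {x : M}
    (hS : DiffEndAlong (m := m) φ S x) (hs : DiffAlong (m := m) φ s x) :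
    DiffAlong (m := m) φ (fun y ↦ S y (s y)) x :=
  MDifferentiableAt.clm_bundle_apply (F₁ := Euc n) (F₂ := Euc n) (ϕ := S) (v := s) hS hs

lemma mvfderiv_clm_apply {E F : Type*} [NormedAddCommGroup E] [NormedSpace ℝ E]
    [NormedAddCommGroup F] [NormedSpace ℝ F] {f : M → E →L[ℝ] F} {g : M → E} {x : M}
    (hf : MDifferentiableAt (𝓡 m) 𝓘(ℝ, E →L[ℝ] F) f x)
    (hg : MDifferentiableAt (𝓡 m) 𝓘(ℝ, E) g x) (X : TangentSpace (𝓡 m) x) :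
    mvfderiv (𝓡 m) (fun y ↦ f y (g y)) x X =
      mvfderiv (𝓡 m) f x X (g x) + f x (mvfderiv (𝓡 m) g x X) := by
  have h := hf.hasMFDerivAt.2.clm_apply hg.hasMFDerivAt.2
  -- The product rule is applied to the expressions in charts; their values at the base point are
  -- those of `f` and `g`.
  have e1 : writtenInExtChartAt (𝓡 m) 𝓘(ℝ, E →L[ℝ] F) x f (extChartAt (𝓡 m) x x) = f x := by
    simp [writtenInExtChartAt, chartAt_self_eq]
  have e2 : writtenInExtChartAt (𝓡 m) 𝓘(ℝ, E) x g (extChartAt (𝓡 m) x x) = g x := by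
    simp [writtenInExtChartAt, chartAt_self_eq]
  rw [e1, e2] at h
  have h' : HasMFDerivAt (𝓡 m) 𝓘(ℝ, F) (fun y ↦ f y (g y)) x _ :=
    ⟨(hf.clm_apply hg).continuousAt, h⟩
  have h2 := congrArg (fun L : TangentSpace (𝓡 m) x →L[ℝ] F ↦ L X) h'.mfderiv
  exact h2.trans (add_comm _ _)

lemma coordDerivative_clm_apply {φ : M → N} {S : Π x : M, EndAt n (φ x)}
    {s : Π x : M, TangentSpace (𝓡 n) (φ x)} {x : M}
    (hS : DiffEndAlong (m := m) φ S x) (hs : DiffAlong (m := m) φ s x)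
    (X : TangentSpace (𝓡 m) x) :
    coordDerivative (m := m) φ (fun y ↦ S y (s y)) x X =
      (coordAt n (φ x)).symm (mvfderiv (𝓡 m)
        (fun y ↦ endCoord (φ x) (⟨φ y, S y⟩ : EndBundle n N)) x X (coordAt n (φ x) (s x))) +
      S x (coordDerivative φ s x X) := by
  have h : (fun x' ↦ (frame n (φ x) (⟨φ x', S x' (s x')⟩ : TangentBundle (𝓡 n) N)).2) =ᶠ[𝓝 x]
      fun y ↦ endCoord (φ x) (⟨φ y, S y⟩ : EndBundle n N)
        ((frame n (φ x) (⟨φ y, s y⟩ : TangentBundle (𝓡 n) N)).2) := by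
    filter_upwards [eventually_mem_frame hs.base] with y hy
    simp only [frame_apply hy, endCoord_apply hy]
  have h2 := mvfderiv_congr h X
  rw [mvfderiv_clm_apply hS.coord hs.coord] at h2
  refine (congrArg (coordAt n (φ x)).symm h2).trans ?_
  rw [map_add, frame_apply (mem_frame_baseSet n (φ x))]
  congr 1
  rw [endCoord_eq (mem_frame_baseSet n (φ x))]
  exact (coordAt n (φ x)).symm_apply_apply _

/-- The Leibniz rule. -/
lemma pullbackConnection_clm_apply (D : Connection n N) {φ : M → N} {S : Π x : M, EndAt n (φ x)}
    {s : Π x : M, TangentSpace (𝓡 n) (φ x)} {x : M}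
    (hS : DiffEndAlong (m := m) φ S x) (hs : DiffAlong (m := m) φ s x)
    (X : TangentSpace (𝓡 m) x) :
    pullbackConnection (m := m) D φ (fun y ↦ S y (s y)) x X =
      endDerivative D φ S x X (s x) + S x (pullbackConnection D φ s x X) := by
  have h1 := endCoordDeriv_mfderiv hS X
  have h2 := dProj_mfderiv hS X
  have h3 := coordDerivative_clm_apply hS hs X
  have h4 : endDerivative D φ S x X (s x) = connector D (φ x) (S x)
    (mfderiv (𝓡 m) (endModel n) (fun y ↦ (⟨φ y, S y⟩ : EndBundle n N)) x X) (s x) := rfl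
  rw [connector_apply, h1, h2] at h4
  rw [pullbackConnection_eq, pullbackConnection_eq, h4, _root_.add_apply, _root_.add_apply, h3,
    map_add]
  simp only [ContinuousLinearMap.comp_apply]
  abel

lemma pullbackConnection_congr (D : Connection n N) {φ : M → N}
    {s t : Π x : M, TangentSpace (𝓡 n) (φ x)} {x : M} (h : ∀ᶠ y in 𝓝 x, s y = t y) :
    pullbackConnection (m := m) D φ s x = pullbackConnection (m := m) D φ t x := by
  rw [pullbackConnection_eq, pullbackConnection_eq, coordDerivative_congr h, h.self_of_nhds]

lemma connection_eq_pullbackConnection (D : Connection n N) {z : N}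
    {Y : Π y : N, TangentSpace (𝓡 n) y} (hY : DiffAlong (m := n) (fun y : N ↦ y) Y z)
    (X : TangentSpace (𝓡 n) z) :
    D Y z X = pullbackConnection (m := n) D (fun y : N ↦ y) Y z X := by
  rw [pullbackConnection_eq, connection_apply D hY, _root_.add_apply, _root_.add_apply]
  congr 1
  have : differential (m := n) (n := n) (fun y : N ↦ y) z X = X := by
    unfold differential
    exact congrArg (fun L : TangentSpace (𝓡 n) z →L[ℝ] TangentSpace (𝓡 n) z ↦ L X)
      (mfderiv_id (I := 𝓡 n) (x := z))
  rw [ContinuousLinearMap.comp_apply, this]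

lemma endDerivative_id_apply (D : Connection n N) {z : N} {S : Π y : N, EndAt n y}
    (hS : DiffEndAlong (m := n) (fun y : N ↦ y) S z) {Y : Π y : N, TangentSpace (𝓡 n) y}
    (hY : DiffAlong (m := n) (fun y : N ↦ y) Y z) (X : TangentSpace (𝓡 n) z) :
    D (fun y ↦ S y (Y y)) z X = endDerivative D (fun y : N ↦ y) S z X (Y z) + S z (D Y z X) := by
  rw [connection_eq_pullbackConnection D hY, connection_eq_pullbackConnection D (hS.apply hY)]
  exact pullbackConnection_clm_apply D hS hY X

end Leibniz

/-! ### The horizontal space is the kernel of the connector -/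

section Horizontal

variable {n : ℕ} {N : Type*} [TopologicalSpace N] [ChartedSpace (Euc n) N] [IsManifold (𝓡 n) ∞ N]

/-- There are functions with a given value and a given nonzero derivative. -/
lemma exists_function_mvfderiv_eq_one (z : N) {X : TangentSpace (𝓡 n) z} (hX : X ≠ 0) :
    ∃ f : N → ℝ, ContMDiffAt (𝓡 n) 𝓘(ℝ, ℝ) ∞ f z ∧ f z = 0 ∧ mvfderiv (𝓡 n) f z X = 1 := by
  have hinv := isInvertible_mfderiv_extChartAt (I := 𝓡 n) (mem_extChartAt_source (I := 𝓡 n) z)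
  have hne : mfderiv (𝓡 n) 𝓘(ℝ, Euc n) (extChartAt (𝓡 n) z) z X ≠ 0 := fun h ↦
    hX (hinv.injective (h.trans (map_zero _).symm))
  let w : Euc n := mfderiv (𝓡 n) 𝓘(ℝ, Euc n) (extChartAt (𝓡 n) z) z X
  have hw : w ≠ 0 := hne
  obtain ⟨l, hl⟩ : ∃ l : Euc n →L[ℝ] ℝ, l w = 1 := SeparatingDual.exists_eq_one hw
  -- The required function is `l`, normalized on the image of `X` in the chart, composed with the
  -- chart and shifted so as to vanish at `z`.
  have hc := contMDiffAt_extChartAt (I := 𝓡 n) (n := ∞) (x := z)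
  have hl' : ContMDiffAt (𝓡 n) 𝓘(ℝ, ℝ) ∞ (fun y ↦ l (extChartAt (𝓡 n) z y)) z :=
    l.contMDiff.contMDiffAt.comp z hc
  refine ⟨fun y ↦ l (extChartAt (𝓡 n) z y) - l (extChartAt (𝓡 n) z z),
    hl'.sub contMDiffAt_const, sub_self _, ?_⟩
  rw [mvfderiv_fun_sub (hl'.mdifferentiableAt (by simp)) mdifferentiableAt_const, mvfderiv_const,
    sub_zero]
  refine Eq.trans ?_ hl
  have := mfderiv_comp_apply (I := 𝓡 n) (I' := 𝓘(ℝ, Euc n)) (I'' := 𝓘(ℝ, ℝ)) z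
    (g := l) (f := extChartAt (𝓡 n) z) l.mdifferentiableAt (hc.mdifferentiableAt (by simp)) X
  refine Eq.trans this ?_
  rw [l.mfderiv_eq]
  rfl

lemma endCoord_add_smul (z : N) (J A : EndAt n z) (t : ℝ) :
    endCoord z (⟨z, J + t • A⟩ : EndBundle n N) =
      endCoord z ⟨z, J⟩ + t • endCoord z (⟨z, A⟩ : EndBundle n N) := by
  ext w : 1
  simp only [endCoord_eq (mem_frame_baseSet n z), _root_.add_apply, _root_.smul_apply, map_add,
    map_smul]

lemma endCoord_injective {z : N} {A A' : EndAt n z}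
    (h : endCoord z (⟨z, A⟩ : EndBundle n N) = endCoord z ⟨z, A'⟩) : A = A' := by
  ext v
  have := DFunLike.congr_fun h (coordEquiv (mem_frame_baseSet n z) v)
  rw [endCoord_apply, endCoord_apply] at this
  exact (coordEquiv (mem_frame_baseSet n z)).injective this

lemma mdifferentiableAt_vertical (z : N) (J A : EndAt n z) (t : ℝ) :
    MDifferentiableAt 𝓘(ℝ, ℝ) (endModel n) (fun t : ℝ ↦ (⟨z, J + t • A⟩ : EndBundle n N)) t := by
  refine (mdifferentiableAt_totalSpace (IB := 𝓡 n) _).2 ⟨mdifferentiableAt_const, ?_⟩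
  have : (fun t : ℝ ↦ endCoord z (⟨z, J + t • A⟩ : EndBundle n N)) =
      fun t ↦ endCoord z ⟨z, J⟩ + t • endCoord z (⟨z, A⟩ : EndBundle n N) :=
    funext (endCoord_add_smul z J A)
  change MDifferentiableAt 𝓘(ℝ, ℝ) 𝓘(ℝ, Euc n →L[ℝ] Euc n)
    (fun t : ℝ ↦ endCoord z (⟨z, J + t • A⟩ : EndBundle n N)) t
  rw [this]
  refine DifferentiableAt.mdifferentiableAt ?_
  fun_prop

lemma dProj_verticalLift (z : N) (J A : EndAt n z) : dProj z J (verticalLift z J A) = 0 := by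
  have h := mfderiv_comp_apply_of_eq (I := 𝓘(ℝ, ℝ)) (I' := endModel n) (I'' := 𝓡 n)
    (f := fun t : ℝ ↦ (⟨z, J + t • A⟩ : EndBundle n N)) (x := 0)
    (mdifferentiableAt_proj z J) (mdifferentiableAt_vertical z J A 0) (by simp) (1 : ℝ)
  refine h.symm.trans ?_
  have : (fun e : EndBundle n N ↦ e.proj) ∘ (fun t : ℝ ↦ (⟨z, J + t • A⟩ : EndBundle n N)) =
    fun _ ↦ z := rfl
  rw [this, mfderiv_const]
  rfl

lemma endCoordDeriv_verticalLift (z : N) (J A : EndAt n z) :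
    endCoordDeriv z J (verticalLift z J A) = endCoord z (⟨z, A⟩ : EndBundle n N) := by
  have h := mfderiv_comp_apply_of_eq (I := 𝓘(ℝ, ℝ)) (I' := endModel n)
    (I'' := 𝓘(ℝ, Euc n →L[ℝ] Euc n))
    (f := fun t : ℝ ↦ (⟨z, J + t • A⟩ : EndBundle n N)) (x := 0)
    (mdifferentiableAt_endCoord z J) (mdifferentiableAt_vertical z J A 0) (by simp) (1 : ℝ)
  refine h.symm.trans ?_
  have : endCoord z ∘ (fun t : ℝ ↦ (⟨z, J + t • A⟩ : EndBundle n N)) =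
      fun t ↦ endCoord z ⟨z, J⟩ + t • endCoord z (⟨z, A⟩ : EndBundle n N) :=
    funext (endCoord_add_smul z J A)
  rw [this, mfderiv_eq_fderiv]
  have hd : HasFDerivAt (fun t : ℝ ↦ endCoord z ⟨z, J⟩ + t • endCoord z (⟨z, A⟩ : EndBundle n N))
      ((ContinuousLinearMap.id ℝ ℝ).smulRight (endCoord z (⟨z, A⟩ : EndBundle n N))) 0 :=
    ((hasFDerivAt_id (0 : ℝ)).smul_const _).const_add _
  have h3 := DFunLike.congr_fun hd.fderiv (1 : ℝ)
  exact Eq.trans h3 (one_smul ℝ _)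

/-- The Christoffel terms vanish because a vertical vector has zero projection. Hence the connector
splits off the vertical part of any tangent vector. -/
lemma connector_verticalLift (D : Connection n N) (z : N) (J A : EndAt n z) :
    connector D z J (verticalLift z J A) = A := by
  ext Y
  rw [connector_apply, dProj_verticalLift, endCoordDeriv_verticalLift,
    endCoord_eq (mem_frame_baseSet n z)]
  simp only [map_zero, add_zero, sub_zero]
  refine ((coordAt n z).symm_apply_apply _).trans ?_
  exact congrArg A ((coordAt n z).symm_apply_apply _)

/-- A vector tangent to the bundle of endomorphisms is determined by its projection and by its image
through the connector. -/
lemma endBundle_tangent_ext' (D : Connection n N) {z : N} {J : EndAt n z}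
    {v w : TangentSpace (endModel n) (⟨z, J⟩ : EndBundle n N)}
    (h1 : dProj z J v = dProj z J w) (h2 : connector D z J v = connector D z J w) : v = w := by
  refine endBundle_tangent_ext h1 ?_
  ext c : 1
  obtain ⟨Y, rfl⟩ := (coordAt n z).surjective c
  have := DFunLike.congr_fun h2 Y
  rw [connector_apply, connector_apply, h1] at this
  exact (coordAt n z).symm.injective (add_right_cancel (sub_left_injective this))

omit [IsManifold (𝓡 n) ∞ N] in
lemma mvfderiv_const_add_smul {F : Type*} [NormedAddCommGroup F] [NormedSpace ℝ F] {z : N}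
    {f : N → ℝ} (hf : MDifferentiableAt (𝓡 n) 𝓘(ℝ, ℝ) f z) (c w : F) (X : TangentSpace (𝓡 n) z) :
    mvfderiv (𝓡 n) (fun y ↦ c + f y • w) z X = mvfderiv (𝓡 n) f z X • w := by
  have hc : MDifferentiableAt (𝓡 n) 𝓘(ℝ, F) (fun _ : N ↦ c) z := mdifferentiableAt_const
  have hw : MDifferentiableAt (𝓡 n) 𝓘(ℝ, F) (fun _ : N ↦ w) z := mdifferentiableAt_const
  have h : MDifferentiableAt (𝓡 n) 𝓘(ℝ, F) (fun y : N ↦ f y • w) z := hf.smul hw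
  rw [mvfderiv_fun_add hc h, mvfderiv_const, zero_add, mvfderiv_fun_smul hf hw, mvfderiv_const,
    smul_zero, zero_add, ContinuousLinearMap.smulRight_apply]

/-- In the trivialization at `z`, take `J + f v'`, with `v'` the derivative of the coordinates along
`v` and `f` a function with `f(z) = 0` and derivative `1` along the projection of `v`. The
projection must be nonzero for such an `f` to exist. -/
lemma exists_section_mfderiv_eq {z : N} {J : EndAt n z}
    (v : TangentSpace (endModel n) (⟨z, J⟩ : EndBundle n N)) (hv : dProj z J v ≠ 0) :
    ∃ S : Π y : N, EndAt n y, S z = J ∧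
      ContMDiffAt (𝓡 n) (endModel n) ∞ (fun y ↦ (⟨y, S y⟩ : EndBundle n N)) z ∧
      v = mfderiv (𝓡 n) (endModel n) (fun y ↦ (⟨y, S y⟩ : EndBundle n N)) z (dProj z J v) := by
  obtain ⟨f, hf, hf0, hf1⟩ := exists_function_mvfderiv_eq_one z hv
  obtain ⟨S, hev⟩ : ∃ S : Π y : N, EndAt n y, (fun y ↦ endCoord z (⟨y, S y⟩ : EndBundle n N)) =ᶠ[𝓝 z]
      fun y ↦ endCoord z ⟨z, J⟩ + f y • endCoordDeriv z J v := by
    let t := trivializationAt (Euc n →L[ℝ] Euc n) (fun y : N ↦ EndAt n y) z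
    have ht : z ∈ t.baseSet := FiberBundle.mem_baseSet_trivializationAt' z
    refine ⟨fun y ↦ t.symm y (endCoord z ⟨z, J⟩ + f y • endCoordDeriv z J v), ?_⟩
    filter_upwards [t.open_baseSet.mem_nhds ht] with y hy
    exact congrArg Prod.snd (t.apply_mk_symm hy _)
  have hSz : S z = J := by
    refine endCoord_injective (hev.self_of_nhds.trans ?_)
    change endCoord z ⟨z, J⟩ + f z • endCoordDeriv z J v = _
    rw [hf0]
    exact (congrArg (_ + ·) (zero_smul ℝ (endCoordDeriv z J v))).trans (add_zero _)
  subst hSz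
  have hcoord : ContMDiffAt (𝓡 n) 𝓘(ℝ, Euc n →L[ℝ] Euc n) ∞
      (fun y ↦ endCoord z ⟨z, S z⟩ + f y • endCoordDeriv z (S z) v) z :=
    contMDiffAt_const.add (hf.smul contMDiffAt_const)
  have hS : ContMDiffAt (𝓡 n) (endModel n) ∞ (fun y ↦ (⟨y, S y⟩ : EndBundle n N)) z :=
    (contMDiffAt_totalSpace (IB := 𝓡 n)).2 ⟨contMDiffAt_id, hcoord.congr_of_eventuallyEq hev⟩
  refine ⟨S, rfl, hS, ?_⟩
  have hSd : DiffEndAlong (m := n) (fun y : N ↦ y) S z := hS.mdifferentiableAt (by simp)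
  have hfd := hf.mdifferentiableAt (by simp)
  refine endBundle_tangent_ext ?_ ?_
  · rw [dProj_mfderiv hSd]
    exact (congrArg (fun L : TangentSpace (𝓡 n) z →L[ℝ] TangentSpace (𝓡 n) z ↦ L (dProj z (S z) v))
      (mfderiv_id (I := 𝓡 n) (x := z))).symm
  · rw [endCoordDeriv_mfderiv hSd, mvfderiv_congr hev, mvfderiv_const_add_smul hfd, hf1, one_smul]

/-- The connector maps `dS(X)` to `∇_X S`, which the Leibniz rule identifies with the defect
`D_X(SY) - S D_X Y`. Conversely, a vector of the kernel with nonzero projection is the velocity of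
some section, which is then parallel in that direction; one with zero projection is zero. -/
lemma horizontalSpace_eq_ker (D : Connection n N) (z : N) (J : EndAt n z) :
    horizontalSpace D z J = LinearMap.ker (connector D z J) := by
  refine le_antisymm (Submodule.span_le.2 ?_) fun v hv ↦ ?_
  · rintro v ⟨S, X, rfl, hS, hSY, rfl⟩
    have hSd : DiffEndAlong (m := n) (fun y : N ↦ y) S z := hS.mdifferentiableAt (by simp)
    change endDerivative D (fun y : N ↦ y) S z X = 0
    ext Y
    have hY := FiberBundle.contMDiffAt_extend (k := ∞) (𝓡 n) (Euc n) Y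
    have hYd := FiberBundle.mdifferentiableAt_extend (𝓡 n) (Euc n) Y
    have h := endDerivative_id_apply D hSd hYd X
    rw [hSY _ hY] at h
    simpa using h
  · rw [LinearMap.mem_ker] at hv
    by_cases hX : dProj z J v = 0
    · have : v = 0 := endBundle_tangent_ext' D (hX.trans (dProj z J).map_zero.symm)
        (hv.trans (map_zero _).symm)
      rw [this]
      exact Submodule.zero_mem _
    · obtain ⟨S, rfl, hS, hvS⟩ := exists_section_mfderiv_eq v hX
      have hSd : DiffEndAlong (m := n) (fun y : N ↦ y) S z := hS.mdifferentiableAt (by simp)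
      refine Submodule.subset_span ⟨S, _, rfl, hS, fun Y hY ↦ ?_, hvS⟩
      have hYd : DiffAlong (m := n) (fun y : N ↦ y) Y z := hY.mdifferentiableAt (by simp)
      rw [endDerivative_id_apply D hSd hYd]
      have : endDerivative D (fun y : N ↦ y) S z (dProj z (S z) v) = 0 := by
        rw [← hv]
        exact congrArg (connector D z (S z)) hvS.symm
      rw [this]
      simp

end Horizontal

/-! ### Real and imaginary parts in the complexification -/

section Complexification

variable {V : Type*} [AddCommGroup V] [Module ℝ V] {V' : Type*} [AddCommGroup V'] [Module ℝ V']

/-- The vector of the complexification of `V` with given real and imaginary parts. -/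
def cplx (a b : V) : ℂ ⊗[ℝ] V := (1 : ℂ) ⊗ₜ[ℝ] a + Complex.I ⊗ₜ[ℝ] b

lemma exists_eq_cplx (Z : ℂ ⊗[ℝ] V) : ∃ a b : V, Z = cplx a b := by
  induction Z with
  | zero => exact ⟨0, 0, by simp [cplx]⟩
  | tmul c v =>
    refine ⟨c.re • v, c.im • v, ?_⟩
    rw [cplx, TensorProduct.tmul_smul, TensorProduct.tmul_smul, TensorProduct.smul_tmul',
      TensorProduct.smul_tmul', ← TensorProduct.add_tmul]
    congr 1
    simp [Complex.re_add_im]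
  | add Z Z' h h' =>
    obtain ⟨a, b, rfl⟩ := h
    obtain ⟨a', b', rfl⟩ := h'
    refine ⟨a + a', b + b', ?_⟩
    simp only [cplx, TensorProduct.tmul_add]
    abel

lemma cplx_inj {a b a' b' : V} (h : cplx a b = cplx a' b') : a = a' ∧ b = b' := by
  constructor
  · have := congrArg (fun Z ↦ TensorProduct.lid ℝ V (Complex.reLm.rTensor V Z)) h
    simpa [cplx] using this
  · have := congrArg (fun Z ↦ TensorProduct.lid ℝ V (Complex.imLm.rTensor V Z)) h
    simpa [cplx] using this

lemma baseChange_cplx (L : V →ₗ[ℝ] V') (a b : V) : L.baseChange ℂ (cplx a b) = cplx (L a) (L b) := by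
  simp [cplx]

/-- Since `-i(a + ib) = b - ia`, the eigenvector equation is read off from its real and imaginary
parts. -/
lemma cplx_mem_antiholomorphicSpace {T : V →ₗ[ℝ] V} {a b : V} :
    cplx a b ∈ antiholomorphicSpace T ↔ T a = b ∧ T b = -a := by
  have h : -Complex.I • cplx a b = cplx b (-a) := by
    simp only [cplx, smul_add, TensorProduct.smul_tmul', TensorProduct.tmul_neg]
    simp [TensorProduct.neg_tmul, add_comm]
  rw [antiholomorphicSpace, Module.End.mem_eigenspace_iff, baseChange_cplx, h]
  refine ⟨cplx_inj, fun h ↦ by rw [h.1, h.2]⟩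

lemma cplx_mem_baseChange {p : Submodule ℝ V} {a b : V} (ha : a ∈ p) (hb : b ∈ p) :
    cplx a b ∈ p.baseChange ℂ :=
  add_mem (Submodule.tmul_mem_baseChange_of_mem _ ha) (Submodule.tmul_mem_baseChange_of_mem _ hb)

lemma baseChange_le_ker {p : Submodule ℝ V} {L : V →ₗ[ℝ] V'} (h : p ≤ LinearMap.ker L) :
    p.baseChange ℂ ≤ LinearMap.ker (L.baseChange ℂ) := by
  rw [Submodule.baseChange_eq_span, Submodule.span_le]
  rintro _ ⟨v, hv, rfl⟩
  have : L v = 0 := h hv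
  simp [this]

end Complexification

/-! ### The eigenbundle in terms of projection and connector -/

section Distribution

variable {d : ℕ} {B : Type*} [TopologicalSpace B] [ChartedSpace (Euc d) B]
  [IsManifold (𝓡 d) ∞ B]

/-- The map `A ↦ -J A`, on endomorphisms. -/
def negComp {z : B} (J : EndAt d z) : EndAt d z →ₗ[ℝ] EndAt d z where
  toFun A := -(J.comp A)
  map_add' A A' := by ext v; simp [add_comm]
  map_smul' a A := by ext v; simp

/-- Subtract the generator `A - i J A` of the vertical `(1,0)`-space, with `A` the connector of `a`:
the remaining real and imaginary parts are horizontal, and they project to a vector of the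
`(-i)`-eigenspace of `J`. The minus sign in `h2` is the one in `A - i J A`. -/
lemma cplx_mem_distribution_of (W : OrientedWeyl d B) {z : B} {J : EndAt d z}
    (hJ : ∀ v, J (J v) = -v) {a b : TangentSpace (endModel d) (⟨z, J⟩ : EndBundle d B)}
    (hA : W.IsFibreTangent z J (connector W.D z J a))
    (h1 : dProj z J b = J (dProj z J a))
    (h2 : connector W.D z J b = -(J.comp (connector W.D z J a))) :
    cplx a b ∈ W.distribution (⟨z, J⟩ : EndBundle d B) := by
  set A := connector W.D z J a with hAdef
  have hZ : cplx a b = cplx (a - verticalLift z J A) (b + verticalLift z J (J.comp A)) +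
      ((1 : ℂ) ⊗ₜ[ℝ] verticalLift z J A - Complex.I ⊗ₜ[ℝ] verticalLift z J (J.comp A)) := by
    simp only [cplx, TensorProduct.tmul_add, TensorProduct.tmul_sub]
    abel
  rw [hZ]
  refine Submodule.add_mem_sup ⟨?_, ?_⟩ (Submodule.subset_span ⟨A, hA, rfl⟩)
  · refine cplx_mem_baseChange ?_ ?_
    · rw [horizontalSpace_eq_ker, LinearMap.mem_ker, map_sub, connector_verticalLift, ← hAdef,
        sub_self]
    · rw [horizontalSpace_eq_ker, LinearMap.mem_ker, map_add, connector_verticalLift, h2,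
        neg_add_cancel]
  · have e1 : dProj z J (a - verticalLift z J A) = dProj z J a := by
      rw [(dProj z J).map_sub, dProj_verticalLift, sub_zero]
    have e2 : dProj z J (b + verticalLift z J (J.comp A)) = dProj z J b := by
      rw [(dProj z J).map_add, dProj_verticalLift, add_zero]
    change (dProj z J).toLinearMap.baseChange ℂ _ ∈ antiholomorphicSpace J.toLinearMap
    rw [baseChange_cplx]
    refine cplx_mem_antiholomorphicSpace.2 ⟨?_, ?_⟩
    · exact (congrArg J e1).trans (h1.symm.trans e2.symm)
    · refine (congrArg J (e2.trans h1)).trans ((hJ _).trans (congrArg _ e1.symm))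

/-- The projection maps both summands of the distribution into the `(-i)`-eigenspace of `J`, and the
connector maps both into that of `A ↦ -J A`; one of the two images is zero each time. -/
lemma of_cplx_mem_distribution (W : OrientedWeyl d B) {z : B} {J : EndAt d z}
    (hJ : ∀ v, J (J v) = -v) {a b : TangentSpace (endModel d) (⟨z, J⟩ : EndBundle d B)}
    (h : cplx a b ∈ W.distribution (⟨z, J⟩ : EndBundle d B)) :
    dProj z J b = J (dProj z J a) ∧
      connector W.D z J b = -(J.comp (connector W.D z J a)) := by
  constructor
  · have hle : W.distribution (⟨z, J⟩ : EndBundle d B) ≤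
        (antiholomorphicSpace J.toLinearMap).comap ((dProj z J).toLinearMap.baseChange ℂ) := by
      refine sup_le inf_le_right (Submodule.span_le.2 ?_)
      rintro _ ⟨A, -, rfl⟩
      change (dProj z J).toLinearMap.baseChange ℂ _ ∈ antiholomorphicSpace J.toLinearMap
      rw [map_sub, LinearMap.baseChange_tmul, LinearMap.baseChange_tmul]
      have e1 : (dProj z J).toLinearMap (verticalLift z J A) = 0 := dProj_verticalLift z J A
      have e2 : (dProj z J).toLinearMap (verticalLift z J (J.comp A)) = 0 :=
        dProj_verticalLift z J _
      rw [e1, e2]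
      simp
    have := hle h
    rw [Submodule.mem_comap, baseChange_cplx, cplx_mem_antiholomorphicSpace] at this
    exact this.1.symm
  · have hle : W.distribution (⟨z, J⟩ : EndBundle d B) ≤
        (antiholomorphicSpace (negComp J)).comap ((connector W.D z J).baseChange ℂ) := by
      refine sup_le (inf_le_left.trans ?_) (Submodule.span_le.2 ?_)
      · refine (baseChange_le_ker (horizontalSpace_eq_ker W.D z J).le).trans ?_
        intro Z hZ
        rw [Submodule.mem_comap, LinearMap.mem_ker.1 hZ]
        exact Submodule.zero_mem _
      · rintro _ ⟨A, -, rfl⟩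
        change (connector W.D z J).baseChange ℂ _ ∈ antiholomorphicSpace (negComp J)
        rw [map_sub, LinearMap.baseChange_tmul, LinearMap.baseChange_tmul, connector_verticalLift,
          connector_verticalLift, sub_eq_add_neg, ← TensorProduct.tmul_neg]
        refine cplx_mem_antiholomorphicSpace.2 ⟨rfl, ?_⟩
        ext v
        simp [negComp, hJ]
    have := hle h
    rw [Submodule.mem_comap, baseChange_cplx, cplx_mem_antiholomorphicSpace] at this
    exact this.1.symm

end Distribution

/-! ### Torsion-free connections have symmetric Christoffel symbols -/

section Torsion

variable {n : ℕ} {N : Type*} [TopologicalSpace N] [ChartedSpace (Euc n) N] [IsManifold (𝓡 n) ∞ N]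

lemma coordEquiv_symm_eq {z y : N} (hy : y ∈ (frame n z).baseSet) (w : Euc n) :
    (coordEquiv hy).symm w =
      mfderivWithin 𝓘(ℝ, Euc n) (𝓡 n) (extChartAt (𝓡 n) z).symm (Set.range (𝓡 n))
        (extChartAt (𝓡 n) z y) w := by
  have h := DFunLike.congr_fun (TangentBundle.symmL_trivializationAt (I := 𝓡 n) hy) w
  refine Eq.trans ?_ h
  exact ((Trivialization.symmL_apply (frame n z) hy w).trans (frame_symm_eq hy w)).symm

lemma extend_eq {z y : N} (hy : y ∈ (frame n z).baseSet) (v : TangentSpace (𝓡 n) z) :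
    FiberBundle.extend (Euc n) v y = (coordEquiv hy).symm (coordAt n z v) := by
  rw [← frame_symm_eq hy]
  exact congrArg ((frame n z).symm y) (frame_apply (mem_frame_baseSet n z) v)

/-- Vector fields with constant coordinates commute. -/
lemma mlieBracket_extend (z : N) (X Y : TangentSpace (𝓡 n) z) :
    VectorField.mlieBracket (𝓡 n) (FiberBundle.extend (Euc n) X) (FiberBundle.extend (Euc n) Y) z
      = 0 := by
  -- Read in the chart at `z`, the extended field is constant, because the tangent trivialization is
  -- the derivative of that chart.
  have key : ∀ v : TangentSpace (𝓡 n) z, VectorField.mpullbackWithin 𝓘(ℝ, Euc n) (𝓡 n)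
      (extChartAt (𝓡 n) z).symm (FiberBundle.extend (Euc n) v) (Set.range (𝓡 n))
      =ᶠ[𝓝 (extChartAt (𝓡 n) z z)] fun _ ↦ coordAt n z v := by
    intro v
    filter_upwards [extChartAt_target_mem_nhds (I := 𝓡 n) z] with u hu
    have hs : (extChartAt (𝓡 n) z).symm u ∈ (frame n z).baseSet := by
      have := (extChartAt (𝓡 n) z).map_target hu
      rwa [extChartAt_source] at this
    have hinv := isInvertible_mfderivWithin_extChartAt_symm (I := 𝓡 n) hu
    rw [VectorField.mpullbackWithin_apply, extend_eq hs, coordEquiv_symm_eq,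
      (extChartAt (𝓡 n) z).right_inv hu]
    exact hinv.inverse_apply_eq.2 rfl
  rw [VectorField.mlieBracket, VectorField.mlieBracketWithin_apply,
    ((key X).filter_mono nhdsWithin_le_nhds).lieBracketWithin_vectorField_eq (key X).self_of_nhds
      ((key Y).filter_mono nhdsWithin_le_nhds) (key Y).self_of_nhds]
  refine (congrArg _ ?_).trans (ContinuousLinearMap.map_zero _)
  simp only [VectorField.lieBracketWithin, fderivWithin_fun_const, Pi.zero_apply,
    _root_.zero_apply, sub_zero]
  rfl

/-- Evaluate the torsion on fields with constant coordinates, whose bracket vanishes. -/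
lemma christoffel_symm {D : Connection n N} (hD : D.torsion = 0) (z : N)
    (X Y : TangentSpace (𝓡 n) z) : christoffel D z X Y = christoffel D z Y X := by
  have h := (CovariantDerivative.torsion_eq_zero_iff D).1 hD
    (FiberBundle.mdifferentiableAt_extend (𝓡 n) (Euc n) X)
    (FiberBundle.mdifferentiableAt_extend (𝓡 n) (Euc n) Y)
  rw [mlieBracket_extend, connection_extend, connection_extend, FiberBundle.extend_apply_self,
    FiberBundle.extend_apply_self] at h
  exact (sub_eq_zero.1 h).symm

end Torsion

/-! ### The second fundamental form and its symmetry -/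

section SecondFundamentalForm

variable {m n : ℕ}
  {M : Type*} [TopologicalSpace M] [ChartedSpace (Euc m) M] [IsManifold (𝓡 m) ∞ M]
  {N : Type*} [TopologicalSpace N] [ChartedSpace (Euc n) N] [IsManifold (𝓡 n) ∞ N]

variable (m n) in
/-- The differential of `φ`, in the preferred frames near `x` and `φ x`. -/
def differentialCoord (φ : M → N) (x y : M) : Euc m →L[ℝ] Euc n :=
  inTangentCoordinates (𝓡 m) (𝓡 n) id φ (mfderiv (𝓡 m) (𝓡 n) φ) x y

lemma differentialCoord_apply {φ : M → N} {x y : M} (hy : y ∈ (frame m x).baseSet)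
    (hφy : φ y ∈ (frame n (φ x)).baseSet) (v : TangentSpace (𝓡 m) y) :
    differentialCoord m n φ x y (coordEquiv hy v) = coordEquiv hφy (differential φ y v) := by
  have h := ContinuousLinearMap.inCoordinates_eq (σ := RingHom.id ℝ) (F := Euc m)
    (E := fun y : M ↦ TangentSpace (𝓡 m) y) (F' := Euc n)
    (E' := fun y : N ↦ TangentSpace (𝓡 n) y) (x₀ := x) (y₀ := φ x) (ϕ := differential φ y) hy hφy
  refine (DFunLike.congr_fun h (coordEquiv hy v)).trans ?_
  exact congrArg (fun w ↦ coordEquiv hφy (differential φ y w)) ((coordEquiv hy).symm_apply_apply v)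

lemma contMDiffAt_differentialCoord {φ : M → N} {x : M} (hφ : ContMDiffAt (𝓡 m) (𝓡 n) ∞ φ x) :
    ContMDiffAt (𝓡 m) 𝓘(ℝ, Euc m →L[ℝ] Euc n) ∞ (differentialCoord m n φ x) x :=
  hφ.mfderiv_const (by simp)

/-- The Hessian of `φ` with respect to the preferred charts. -/
def hessian (φ : M → N) (x : M) (X Y : TangentSpace (𝓡 m) x) : TangentSpace (𝓡 n) (φ x) :=
  (coordAt n (φ x)).symm (mvfderiv (𝓡 m) (differentialCoord m n φ x) x X (coordAt m x Y))

lemma contMDiffAt_differential_apply {φ : M → N} {x : M} (hφ : ContMDiff (𝓡 m) (𝓡 n) ∞ φ)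
    {Y : Π y : M, TangentSpace (𝓡 m) y} (hY : SmoothFieldAt Y x) :
    ContMDiffAt (𝓡 m) (𝓡 n).tangent ∞
      (fun y ↦ (⟨φ y, differential φ y (Y y)⟩ : TangentBundle (𝓡 n) N)) x :=
  ContMDiffAt.clm_apply_of_inCoordinates (F₁ := Euc m) (F₂ := Euc n) (b₁ := id) (b₂ := φ)
    (ϕ := fun y ↦ differential φ y) (v := Y) (contMDiffAt_differentialCoord hφ.contMDiffAt) hY
    hφ.contMDiffAt

lemma coordDerivative_differential {φ : M → N} {x : M} (hφ : ContMDiff (𝓡 m) (𝓡 n) ∞ φ)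
    {Y : Π y : M, TangentSpace (𝓡 m) y} (hY : DiffAlong (m := m) (fun y : M ↦ y) Y x)
    (X : TangentSpace (𝓡 m) x) :
    coordDerivative (m := m) φ (fun y ↦ differential φ y (Y y)) x X =
      hessian (n := n) φ x X (Y x) + differential φ x (coordDerivative (m := m) (fun y ↦ y) Y x X) := by
  have hd : MDifferentiableAt (𝓡 m) (𝓡 n) φ x := hφ.contMDiffAt.mdifferentiableAt (by simp)
  have h : (fun x' ↦ (frame n (φ x)
      (⟨φ x', differential φ x' (Y x')⟩ : TangentBundle (𝓡 n) N)).2) =ᶠ[𝓝 x]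
      fun y ↦ differentialCoord m n φ x y ((frame m x (⟨y, Y y⟩ : TangentBundle (𝓡 m) M)).2) := by
    filter_upwards [eventually_mem_frame hd, frame_baseSet_mem_nhds m x] with y hy hy'
    rw [frame_apply hy, frame_apply hy', differentialCoord_apply hy' hy]
  have h2 := mvfderiv_congr h X
  rw [mvfderiv_clm_apply
    ((contMDiffAt_differentialCoord hφ.contMDiffAt).mdifferentiableAt (by simp)) hY.coord] at h2
  refine (congrArg (coordAt n (φ x)).symm h2).trans ?_
  rw [map_add, frame_apply (mem_frame_baseSet m x)]
  congr 1
  rw [ContinuousLinearEquiv.symm_apply_eq]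
  refine Eq.trans ?_ (differentialCoord_apply (mem_frame_baseSet m x)
    (mem_frame_baseSet n (φ x)) _)
  exact congrArg _ ((coordAt m x).apply_symm_apply _).symm

/-- The explicit form of the second fundamental form. -/
def sff (DM : Connection m M) (DN : Connection n N) (φ : M → N) (x : M)
    (X Y : TangentSpace (𝓡 m) x) : TangentSpace (𝓡 n) (φ x) :=
  hessian φ x X Y + christoffel DN (φ x) (differential φ x Y) (differential φ x X) -
    differential φ x (christoffel DM x Y X)

/-- The derivatives of `Y` enter `D^N_X (dφ Y)` and `dφ(D^M_X Y)` in the same way. So the second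
fundamental form may be computed with any differentiable field, in particular with `J Y`. -/
lemma pullbackConnection_differential (DM : Connection m M) (DN : Connection n N) {φ : M → N}
    {x : M} (hφ : ContMDiff (𝓡 m) (𝓡 n) ∞ φ)
    {Y : Π y : M, TangentSpace (𝓡 m) y} (hY : DiffAlong (m := m) (fun y : M ↦ y) Y x)
    (X : TangentSpace (𝓡 m) x) :
    pullbackConnection (m := m) DN φ (fun y ↦ differential φ y (Y y)) x X =
      sff DM DN φ x X (Y x) + differential φ x (DM Y x X) := by
  rw [pullbackConnection_eq, _root_.add_apply, coordDerivative_differential hφ hY,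
    connection_apply DM hY, _root_.add_apply, map_add, sff, ContinuousLinearMap.comp_apply]
  abel

lemma secondFundamentalForm_eq (DM : Connection m M) (DN : Connection n N) {φ : M → N}
    (hφ : ContMDiff (𝓡 m) (𝓡 n) ∞ φ) (x : M) (X Y : TangentSpace (𝓡 m) x) :
    secondFundamentalForm DM DN φ x X Y = sff DM DN φ x X Y := by
  rw [secondFundamentalForm, pullbackConnection_differential DM DN hφ
    (FiberBundle.mdifferentiableAt_extend ..), FiberBundle.extend_apply_self, add_sub_cancel_right]

lemma coordAt_eq_mfderiv (x : M) (v : TangentSpace (𝓡 m) x) :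
    coordAt m x v = mfderiv (𝓡 m) 𝓘(ℝ, Euc m) (extChartAt (𝓡 m) x) x v := by
  have h := TangentBundle.continuousLinearMapAt_trivializationAt (I := 𝓡 m) (mem_frame_baseSet m x)
  refine Eq.trans ?_ (DFunLike.congr_fun h v)
  exact ((frame m x).continuousLinearMapAt_apply_of_mem _ (mem_frame_baseSet m x) v).symm

lemma hessian_symm {φ : M → N} (hφ : ContMDiff (𝓡 m) (𝓡 n) ∞ φ) (x : M)
    (X Y : TangentSpace (𝓡 m) x) : hessian (n := n) φ x X Y = hessian φ x Y X := by
  have hd : MDifferentiable (𝓡 m) (𝓡 n) φ := hφ.mdifferentiable (by simp)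
  let f : Euc m → Euc n := extChartAt (𝓡 n) (φ x) ∘ φ ∘ (extChartAt (𝓡 m) x).symm
  have hf : ContDiffAt ℝ ∞ f (extChartAt (𝓡 m) x x) := by
    have := (contMDiffAt_iff.1 (hφ.contMDiffAt (x := x))).2
    rw [ModelWithCorners.range_eq_univ] at this
    exact contDiffWithinAt_univ.1 this
  -- Near `x`, the differential in frames is the derivative of the local representative `f`, so the
  -- Hessian is the second derivative of `f` and Schwarz's theorem applies.
  have hF : differentialCoord m n φ x =ᶠ[𝓝 x] fderiv ℝ f ∘ extChartAt (𝓡 m) x := by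
    filter_upwards [eventually_mem_frame (hd x), frame_baseSet_mem_nhds m x] with y hy hy'
    have hys : y ∈ (extChartAt (𝓡 m) x).source := by rwa [extChartAt_source]
    have hyi := (extChartAt (𝓡 m) x).left_inv hys
    have e1 : MDifferentiableAt 𝓘(ℝ, Euc m) (𝓡 m) (extChartAt (𝓡 m) x).symm
        (extChartAt (𝓡 m) x y) := by
      have := mdifferentiableWithinAt_extChartAt_symm (I := 𝓡 m)
        ((extChartAt (𝓡 m) x).map_source hys)
      rw [ModelWithCorners.range_eq_univ] at this
      exact mdifferentiableWithinAt_univ.1 this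
    have e2 := mdifferentiableAt_extChartAt (I := 𝓡 n) hy
    have h1 : mfderiv (𝓡 m) 𝓘(ℝ, Euc n) (extChartAt (𝓡 n) (φ x) ∘ φ) y = _ :=
      mfderiv_comp y e2 (hd y)
    have h2 : mfderiv 𝓘(ℝ, Euc m) 𝓘(ℝ, Euc n)
        ((extChartAt (𝓡 n) (φ x) ∘ φ) ∘ (extChartAt (𝓡 m) x).symm) (extChartAt (𝓡 m) x y) = _ :=
      mfderiv_comp_of_eq (e2.comp y (hd y)) e1 hyi
    rw [differentialCoord, inTangentCoordinates_eq_mfderiv_comp hy' hy,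
      ModelWithCorners.range_eq_univ, mfderivWithin_univ, Function.comp_apply,
      ← mfderiv_eq_fderiv]
    refine Eq.trans ?_ h2.symm
    rw [hyi]
    exact congrArg (fun L ↦ ContinuousLinearMap.comp L _) h1.symm
  have hD : DifferentiableAt ℝ (fderiv ℝ f) (extChartAt (𝓡 m) x x) :=
    (hf.fderiv_right (m := 1) (by rw [one_add_one_eq_two]; exact ENat.LEInfty.out)).differentiableAt (by simp)
  have hX : ∀ X : TangentSpace (𝓡 m) x, mvfderiv (𝓡 m) (differentialCoord m n φ x) x X =
      fderiv ℝ (fderiv ℝ f) (extChartAt (𝓡 m) x x) (coordAt m x X) := by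
    intro X
    rw [mvfderiv_congr hF, coordAt_eq_mfderiv]
    have := mfderiv_comp_apply (I := 𝓡 m) (I' := 𝓘(ℝ, Euc m)) (I'' := 𝓘(ℝ, Euc m →L[ℝ] Euc n)) x
      hD.mdifferentiableAt (mdifferentiableAt_extChartAt (I := 𝓡 m) (mem_frame_baseSet m x)) X
    rw [mfderiv_eq_fderiv] at this
    exact this
  rw [hessian, hessian, hX, hX]
  have := hf.isSymmSndFDerivAt (by rw [minSmoothness_of_isRCLikeNormedField]; exact ENat.LEInfty.out) (coordAt m x X) (coordAt m x Y)
  rw [this]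

/-- The Hessian is symmetric, and so are the Christoffel terms of both torsion-free connections. -/
lemma sff_symm {DM : Connection m M} {DN : Connection n N} (hM : DM.torsion = 0)
    (hN : DN.torsion = 0) {φ : M → N} (hφ : ContMDiff (𝓡 m) (𝓡 n) ∞ φ) (x : M)
    (X Y : TangentSpace (𝓡 m) x) : sff DM DN φ x X Y = sff DM DN φ x Y X := by
  rw [sff, sff, hessian_symm hφ, christoffel_symm hM, christoffel_symm hN]

lemma sff_neg_left (DM : Connection m M) (DN : Connection n N) (φ : M → N) (x : M)
    (X Y : TangentSpace (𝓡 m) x) : sff DM DN φ x (-X) Y = -sff DM DN φ x X Y := by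
  simp only [sff, hessian, map_neg, _root_.neg_apply]
  abel

end SecondFundamentalForm

/-! ### Compatibility of the pull-back connection with the conformal structure -/

section Metric

variable {m n : ℕ}
  {M : Type*} [TopologicalSpace M] [ChartedSpace (Euc m) M]
  {N : Type*} [TopologicalSpace N] [ChartedSpace (Euc n) N] [IsManifold (𝓡 n) ∞ N]

/-- The coordinates of a metric in the conformal class. -/
def metricCoord (c : ConformalStructure n N) (z y : N) : Euc n →L[ℝ] Euc n →L[ℝ] ℝ :=
  ContinuousLinearMap.inCoordinates (Euc n) (fun y : N ↦ TangentSpace (𝓡 n) y) (Euc n →L[ℝ] ℝ)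
    (fun y : N ↦ TangentSpace (𝓡 n) y →L[ℝ] ℝ) z y z y (c.metric.inner y)

lemma mdifferentiableAt_metricCoord (c : ConformalStructure n N) (z : N) :
    MDifferentiableAt (𝓡 n) 𝓘(ℝ, Euc n →L[ℝ] Euc n →L[ℝ] ℝ) (metricCoord c z) z :=
  (((contMDiffAt_totalSpace (IB := 𝓡 n)).1 (c.metric.contMDiff z)).2).mdifferentiableAt (by simp)

lemma metricCoord_apply (c : ConformalStructure n N) {z y : N} (hy : y ∈ (frame n z).baseSet)
    (v w : TangentSpace (𝓡 n) y) :
    metricCoord c z y (coordEquiv hy v) (coordEquiv hy w) = c.form y v w := by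
  rw [metricCoord, inCoordinates_apply_eq₂ hy hy (Set.mem_univ _),
    frame_symm_eq hy, frame_symm_eq hy, ContinuousLinearEquiv.symm_apply_apply,
    ContinuousLinearEquiv.symm_apply_apply]
  simp
  rfl

lemma mvfderiv_clm_apply₂ {E : Type*} [NormedAddCommGroup E] [NormedSpace ℝ E]
    {f : M → E →L[ℝ] E →L[ℝ] ℝ} {g h : M → E} {x : M}
    (hf : MDifferentiableAt (𝓡 m) 𝓘(ℝ, E →L[ℝ] E →L[ℝ] ℝ) f x)
    (hg : MDifferentiableAt (𝓡 m) 𝓘(ℝ, E) g x) (hh : MDifferentiableAt (𝓡 m) 𝓘(ℝ, E) h x)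
    (X : TangentSpace (𝓡 m) x) :
    mvfderiv (𝓡 m) (fun y ↦ f y (g y) (h y)) x X =
      mvfderiv (𝓡 m) f x X (g x) (h x) + f x (mvfderiv (𝓡 m) g x X) (h x) +
        f x (g x) (mvfderiv (𝓡 m) h x X) := by
  have hfg : MDifferentiableAt (𝓡 m) 𝓘(ℝ, E →L[ℝ] ℝ) (fun y ↦ f y (g y)) x := hf.clm_apply hg
  rw [mvfderiv_clm_apply hfg hh, mvfderiv_clm_apply hf hg, _root_.add_apply]

/-- This is the Weyl identity on fields with constant coordinates: only the derivative of the metric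
coefficients remains on the left. -/
lemma mvfderiv_metricCoord {c : ConformalStructure n N} {D : Connection n N}
    {α : Π y : N, TangentSpace (𝓡 n) y →L[ℝ] ℝ}
    (hα : ∀ (y : N) (X : TangentSpace (𝓡 n) y) (Y Z : Π y : N, TangentSpace (𝓡 n) y),
      SmoothFieldAt Y y → SmoothFieldAt Z y →
      mvfderiv (𝓡 n) (fun y ↦ c.form y (Y y) (Z y)) y X =
        c.form y (D Y y X) (Z y) + c.form y (Y y) (D Z y X) + α y X * c.form y (Y y) (Z y))
    (z : N) (X v w : TangentSpace (𝓡 n) z) :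
    mvfderiv (𝓡 n) (metricCoord c z) z X (coordAt n z v) (coordAt n z w) =
      c.form z (christoffel D z v X) w + c.form z v (christoffel D z w X) +
        α z X * c.form z v w := by
  have h := hα z X _ _ (FiberBundle.contMDiffAt_extend (k := ∞) (𝓡 n) (Euc n) v)
    (FiberBundle.contMDiffAt_extend (k := ∞) (𝓡 n) (Euc n) w)
  have hev : (fun y ↦ c.form y (FiberBundle.extend (Euc n) v y) (FiberBundle.extend (Euc n) w y))
      =ᶠ[𝓝 z] fun y ↦ metricCoord c z y (coordAt n z v) (coordAt n z w) := by
    filter_upwards [frame_baseSet_mem_nhds n z, extend_coord_eventually z v,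
      extend_coord_eventually z w] with y hy h1 h2
    rw [← h1, ← h2, frame_apply hy, frame_apply hy, metricCoord_apply]
  rw [mvfderiv_congr hev, mvfderiv_clm_apply₂ (mdifferentiableAt_metricCoord c z)
    mdifferentiableAt_const mdifferentiableAt_const, mvfderiv_const, mvfderiv_const,
    connection_extend, connection_extend, FiberBundle.extend_apply_self,
    FiberBundle.extend_apply_self] at h
  simpa using h

/-- The Weyl identity concerns vector fields on `N`, whereas sections along `φ` need not come from
such fields. So it is converted into an identity for the metric coefficients, composed with `φ` by
the chain rule, and combined with the product rule. -/
lemma exists_mvfderiv_form {c : ConformalStructure n N} {D : Connection n N}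
    (hD : IsWeylConnection c D) :
    ∃ α : Π y : N, TangentSpace (𝓡 n) y →L[ℝ] ℝ, ∀ (φ : M → N) (x : M)
      (s t : Π y : M, TangentSpace (𝓡 n) (φ y)), DiffAlong (m := m) φ s x →
      DiffAlong (m := m) φ t x → ∀ X : TangentSpace (𝓡 m) x,
      mvfderiv (𝓡 m) (fun y ↦ c.form (φ y) (s y) (t y)) x X =
        c.form (φ x) (pullbackConnection (m := m) D φ s x X) (t x) +
        c.form (φ x) (s x) (pullbackConnection (m := m) D φ t x X) +
        α (φ x) (differential φ x X) * c.form (φ x) (s x) (t x) := by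
  obtain ⟨α, hα⟩ := hD.conformal
  refine ⟨α, fun φ x s t hs ht X ↦ ?_⟩
  have hev : (fun y ↦ c.form (φ y) (s y) (t y)) =ᶠ[𝓝 x]
      fun y ↦ (metricCoord c (φ x) (φ y))
        ((frame n (φ x) (⟨φ y, s y⟩ : TangentBundle (𝓡 n) N)).2)
        ((frame n (φ x) (⟨φ y, t y⟩ : TangentBundle (𝓡 n) N)).2) := by
    filter_upwards [eventually_mem_frame hs.base] with y hy
    rw [frame_apply hy, frame_apply hy, metricCoord_apply]
  have hG := mdifferentiableAt_metricCoord c (φ x)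
  have h1 : mvfderiv (𝓡 m) (fun y ↦ metricCoord c (φ x) (φ y)) x X =
      mvfderiv (𝓡 n) (metricCoord c (φ x)) (φ x) (differential φ x X) :=
    mfderiv_comp_apply (I := 𝓡 m) (I' := 𝓡 n) x hG hs.base X
  have e : ∀ u v : TangentSpace (𝓡 n) (φ x),
      metricCoord c (φ x) (φ x) (coordAt n (φ x) u) (coordAt n (φ x) v) = c.form (φ x) u v :=
    metricCoord_apply c (mem_frame_baseSet n (φ x))
  have hc : ∀ r : Π y : M, TangentSpace (𝓡 n) (φ y),
      mvfderiv (𝓡 m) (fun y ↦ (frame n (φ x) (⟨φ y, r y⟩ : TangentBundle (𝓡 n) N)).2) x X =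
      coordAt n (φ x) (coordDerivative φ r x X) := fun r ↦
    ((coordAt n (φ x)).apply_symm_apply _).symm
  have hGφ : MDifferentiableAt (𝓡 m) 𝓘(ℝ, Euc n →L[ℝ] Euc n →L[ℝ] ℝ)
    (fun y ↦ metricCoord c (φ x) (φ y)) x := MDifferentiableAt.comp x hG hs.base
  rw [mvfderiv_congr hev, mvfderiv_clm_apply₂ hGφ hs.coord ht.coord]
  have h2 := congrArg (fun L : Euc n →L[ℝ] Euc n →L[ℝ] ℝ ↦
    L (coordAt n (φ x) (s x)) (coordAt n (φ x) (t x))) h1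
  have h3 := mvfderiv_metricCoord hα (φ x) (differential φ x X) (s x) (t x)
  rw [frame_apply (mem_frame_baseSet n (φ x)), frame_apply (mem_frame_baseSet n (φ x)), hc, hc]
  refine (congrArg₂ (· + ·) (congrArg₂ (· + ·) (h2.trans h3) (e _ _)) (e _ _)).trans ?_
  rw [pullbackConnection_eq, pullbackConnection_eq]
  simp only [_root_.add_apply, ContinuousLinearMap.comp_apply, map_add, LinearMap.add_apply]
  ring

end Metric

/-! ### Covariant derivatives of orthogonal complex structures -/

section Along

variable {m n : ℕ}
  {M : Type*} [TopologicalSpace M] [ChartedSpace (Euc m) M]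
  {N : Type*} [TopologicalSpace N] [ChartedSpace (Euc n) N] [IsManifold (𝓡 n) ∞ N]

/-- A local section along `φ` through a given vector. -/
def extendAlong (φ : M → N) {x : M} (v : TangentSpace (𝓡 n) (φ x)) (y : M) :
    TangentSpace (𝓡 n) (φ y) :=
  FiberBundle.extend (Euc n) v (φ y)

omit [TopologicalSpace M] in
@[simp] lemma extendAlong_self (φ : M → N) {x : M} (v : TangentSpace (𝓡 n) (φ x)) :
    extendAlong φ v x = v :=
  FiberBundle.extend_apply_self ..

lemma contMDiffAt_extendAlong {φ : M → N} {x : M} (hφ : ContMDiffAt (𝓡 m) (𝓡 n) ∞ φ x)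
    (v : TangentSpace (𝓡 n) (φ x)) :
    ContMDiffAt (𝓡 m) (𝓡 n).tangent ∞
      (fun y ↦ (⟨φ y, extendAlong φ v y⟩ : TangentBundle (𝓡 n) N)) x :=
  (FiberBundle.contMDiffAt_extend (k := ∞) (𝓡 n) (Euc n) v).comp x hφ

lemma diffAlong_extendAlong {φ : M → N} {x : M} (hφ : MDifferentiableAt (𝓡 m) (𝓡 n) φ x)
    (v : TangentSpace (𝓡 n) (φ x)) : DiffAlong (m := m) φ (extendAlong φ v) x :=
  (FiberBundle.mdifferentiableAt_extend (𝓡 n) (Euc n) v).comp x hφ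

lemma pullbackConnection_neg (D : Connection n N) {φ : M → N}
    {s : Π x : M, TangentSpace (𝓡 n) (φ x)} {x : M} (hs : DiffAlong (m := m) φ s x) :
    pullbackConnection (m := m) D φ (fun y ↦ -s y) x = -pullbackConnection D φ s x := by
  have h := coordDerivative_smul (m := m) (f := fun _ ↦ (-1 : ℝ)) mdifferentiableAt_const hs
  have e : (fun _ : M ↦ (-1 : ℝ)) • s = fun y ↦ -s y := funext fun y ↦ neg_one_smul ℝ (s y)
  rw [mvfderiv_const, e] at h
  rw [pullbackConnection_eq, pullbackConnection_eq, h]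
  ext v
  simp
  abel

/-- Differentiate `S² = -1` and `g(S·, S·) = g`. In the second, the terms with the one-form `α` of
the Weyl connection are the same on both sides and cancel. -/
lemma isFibreTangent_endDerivative (W : OrientedWeyl n N) {φ : M → N} {S : Π x : M, EndAt n (φ x)}
    {x : M} (hS : DiffEndAlong (m := m) φ S x)
    (hmem : ∀ y, (⟨φ y, S y⟩ : EndBundle n N) ∈ W.twistorBundle) (X : TangentSpace (𝓡 m) x) :
    W.IsFibreTangent (φ x) (S x) (endDerivative W.D φ S x X) := by
  have hsq : ∀ y v, S y (S y v) = -v := fun y ↦ (hmem y).sq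
  have horth : ∀ y v w, W.c.form (φ y) (S y v) (S y w) = W.c.form (φ y) v w :=
    fun y ↦ (hmem y).orthogonal
  have hanti : ∀ v, endDerivative W.D φ S x X (S x v) = -S x (endDerivative W.D φ S x X v) := by
    intro v
    have hs := diffAlong_extendAlong hS.base v
    have h1 := pullbackConnection_clm_apply W.D hS (hS.apply hs) X
    have e : (fun y ↦ S y (S y (extendAlong φ v y))) = fun y ↦ -extendAlong φ v y :=
      funext fun y ↦ hsq y _
    rw [e, pullbackConnection_neg W.D hs, pullbackConnection_clm_apply W.D hS hs, map_add, hsq,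
      extendAlong_self, _root_.neg_apply] at h1
    rw [eq_neg_iff_add_eq_zero]
    have := sub_eq_zero.2 h1.symm
    rw [← this]
    abel
  refine ⟨hanti, fun v w ↦ ?_⟩
  obtain ⟨α, hα⟩ := exists_mvfderiv_form (M := M) (m := m) W.isWeyl
  have key : ∀ v w, W.c.form (φ x) (endDerivative W.D φ S x X v) (S x w) =
      -W.c.form (φ x) (S x v) (endDerivative W.D φ S x X w) := by
    intro v w
    have hv := diffAlong_extendAlong hS.base v
    have hw := diffAlong_extendAlong hS.base w
    have h1 := hα φ x _ _ hv hw X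
    have h2 := hα φ x _ _ (hS.apply hv) (hS.apply hw) X
    simp only [horth] at h2
    rw [h1, pullbackConnection_clm_apply W.D hS hv, pullbackConnection_clm_apply W.D hS hw] at h2
    simp only [map_add, LinearMap.add_apply, horth, extendAlong_self] at h2
    linarith
  -- With `A = ∇_X S`, anticommutation and orthogonality turn `g(A S v, S w) = -g(S S v, A w)` into
  -- `-g(A v, w) = g(v, A w)`.
  have h := key (S x v) w
  rw [hanti, map_neg, LinearMap.neg_apply, horth, hsq, map_neg, LinearMap.neg_apply] at h
  linarith

end Along

/-! ### The normal space and its complex structures -/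

section NormalSpace

variable {m n : ℕ}
  {M : Type*} [TopologicalSpace M] [ChartedSpace (Euc m) M]
  {N : Type*} [TopologicalSpace N] [ChartedSpace (Euc n) N] [IsManifold (𝓡 n) ∞ N]

lemma form_symm (c : ConformalStructure n N) (z : N) (v w : TangentSpace (𝓡 n) z) :
    c.form z v w = c.form z w v :=
  c.metric.symm z v w

lemma form_self_eq_zero {c : ConformalStructure n N} {z : N} {v : TangentSpace (𝓡 n) z}
    (h : c.form z v v = 0) : v = 0 := by
  by_contra hv
  exact (c.metric.pos z v hv).ne' h

/-- The form is definite, so the image of `dφ` meets its orthogonal only in zero; in finite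
dimension the two are then complementary. -/
lemma exists_add_normal (c : ConformalStructure n N) (φ : M → N) (x : M)
    (w : TangentSpace (𝓡 n) (φ x)) :
    ∃ (a : TangentSpace (𝓡 m) x) (U : TangentSpace (𝓡 n) (φ x)),
      U ∈ normalSpace (m := m) c φ x ∧ w = differential φ x a + U := by
  have : FiniteDimensional ℝ (TangentSpace (𝓡 n) (φ x)) :=
    inferInstanceAs (FiniteDimensional ℝ (Euc n))
  have hrefl : (c.form (φ x)).IsRefl := fun v w h ↦ (form_symm c _ w v).trans h
  have hcompl := (LinearMap.BilinForm.isCompl_orthogonal_iff_disjoint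
    (W := (differential (m := m) φ x).toLinearMap.range) hrefl).2
    (Submodule.disjoint_def.2 fun v hv hv' ↦ form_self_eq_zero (hv' v hv))
  have hw : w ∈ (differential (m := m) φ x).toLinearMap.range ⊔
      (c.form (φ x)).orthogonal (differential (m := m) φ x).toLinearMap.range := by
    rw [hcompl.sup_eq_top]; trivial
  obtain ⟨_, ⟨a, rfl⟩, U, hU, rfl⟩ := Submodule.mem_sup.1 hw
  exact ⟨a, U, fun X ↦ (form_symm c _ _ _).trans (hU _ ⟨X, rfl⟩), rfl⟩

lemma sq_mem_normalSpace {c : ConformalStructure n N} {φ : M → N} {x : M} {K : EndAt n (φ x)}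
    (hK : IsNormalEnd (m := m) c φ x K) (w : TangentSpace (𝓡 n) (φ x)) :
    K w ∈ normalSpace (m := m) c φ x := by
  obtain ⟨a, U, hU, rfl⟩ := exists_add_normal (m := m) c φ x w
  rw [map_add, hK.tangent, zero_add]
  exact hK.normal U hU

/-- A complex structure `K` on the normal space, extended by zero. -/
structure IsNormalComplexStructure (c : ConformalStructure n N) (φ : M → N) (x : M)
    (K : EndAt n (φ x)) : Prop where
  normalEnd : IsNormalEnd (m := m) c φ x K
  sq : ∀ U ∈ normalSpace (m := m) c φ x, K (K U) = -U

namespace IsNormalComplexStructure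

variable {c : ConformalStructure n N} {φ : M → N} {x : M} {K : EndAt n (φ x)}

lemma apply_mem (hK : IsNormalComplexStructure (m := m) c φ x K) (w : TangentSpace (𝓡 n) (φ x)) :
    K w ∈ normalSpace (m := m) c φ x :=
  sq_mem_normalSpace hK.normalEnd w

lemma cube (hK : IsNormalComplexStructure (m := m) c φ x K) (w : TangentSpace (𝓡 n) (φ x)) :
    K (K (K w)) = -K w :=
  hK.sq _ (hK.apply_mem w)

/-- The orthogonal projection onto the normal space is `-K²`. -/
lemma exists_eq_sub_sq (hK : IsNormalComplexStructure (m := m) c φ x K)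
    (w : TangentSpace (𝓡 n) (φ x)) :
    ∃ a : TangentSpace (𝓡 m) x, w = differential φ x a - K (K w) := by
  obtain ⟨a, U, hU, rfl⟩ := exists_add_normal (m := m) c φ x w
  refine ⟨a, ?_⟩
  rw [map_add, hK.normalEnd.tangent, zero_add, hK.sq U hU, sub_neg_eq_add]

lemma mem_range (hK : IsNormalComplexStructure (m := m) c φ x K) {w : TangentSpace (𝓡 n) (φ x)}
    (hw : K w = 0) : w ∈ (differential (m := m) φ x).toLinearMap.range := by
  obtain ⟨a, ha⟩ := hK.exists_eq_sub_sq w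
  rw [hw, map_zero, sub_zero] at ha
  exact ⟨a, ha.symm⟩

lemma form_sq_left (hK : IsNormalComplexStructure (m := m) c φ x K) (w : TangentSpace (𝓡 n) (φ x))
    {U : TangentSpace (𝓡 n) (φ x)} (hU : U ∈ normalSpace (m := m) c φ x) :
    c.form (φ x) (K (K w)) U = -c.form (φ x) w U := by
  obtain ⟨a, ha⟩ := hK.exists_eq_sub_sq w
  have h := congrArg (fun v ↦ c.form (φ x) v U) ha
  simp only [map_sub, LinearMap.sub_apply] at h
  rw [form_symm c _ (differential φ x a), hU a] at h
  linarith

end IsNormalComplexStructure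

end NormalSpace

/-! ### The complex structure whose isotropic space is a direct sum -/

section Sum

variable {m n : ℕ}
  {M : Type*} [TopologicalSpace M] [ChartedSpace (Euc m) M]
  {N : Type*} [TopologicalSpace N] [ChartedSpace (Euc n) N]

lemma cplx_mem_antiholomorphicSpace_of_sq {V : Type*} [AddCommGroup V] [Module ℝ V]
    {T : V →ₗ[ℝ] V} {a : V} (h : T (T a) = -a) : cplx a (T a) ∈ antiholomorphicSpace T :=
  cplx_mem_antiholomorphicSpace.2 ⟨rfl, h⟩

variable {φ : M → N} {x : M} {J : EndAt m x} {K S : EndAt n (φ x)}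

/-- A real vector `v` enters through `v + i J v`; its image is in the `(-i)`-eigenspace of `S`, and
the real part of the eigenvector equation gives the claim. -/
lemma sum_apply_differential
    (h : antiholomorphicSpace S.toLinearMap =
      (antiholomorphicSpace J.toLinearMap).map ((differential φ x).toLinearMap.baseChange ℂ) ⊔
        antiholomorphicSpace K.toLinearMap) (hJ : ∀ v, J (J v) = -v) (v : TangentSpace (𝓡 m) x) :
    S (differential φ x v) = differential φ x (J v) := by
  have h1 : cplx v (J v) ∈ antiholomorphicSpace J.toLinearMap :=
    cplx_mem_antiholomorphicSpace_of_sq (hJ v)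
  have h2 := h.ge (Submodule.mem_sup_left (Submodule.mem_map_of_mem h1))
  rw [baseChange_cplx] at h2
  exact (cplx_mem_antiholomorphicSpace.1 h2).1

lemma sum_apply_of_sq
    (h : antiholomorphicSpace S.toLinearMap =
      (antiholomorphicSpace J.toLinearMap).map ((differential φ x).toLinearMap.baseChange ℂ) ⊔
        antiholomorphicSpace K.toLinearMap) {U : TangentSpace (𝓡 n) (φ x)} (hU : K (K U) = -U) : S U = K U := by
  have h1 : cplx U (K U) ∈ antiholomorphicSpace K.toLinearMap :=
    cplx_mem_antiholomorphicSpace_of_sq hU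
  exact (cplx_mem_antiholomorphicSpace.1 (h.ge (Submodule.mem_sup_right h1))).1

end Sum

/-! ### Tangent vectors of the product containing the normal twistor bundle -/

section Product

variable {m n : ℕ}
  {M : Type*} [TopologicalSpace M] [ChartedSpace (Euc m) M]
  {N : Type*} [TopologicalSpace N] [ChartedSpace (Euc n) N] [IsManifold (𝓡 n) ∞ N]

/-- A tangent vector to the product of `M` with the bundle of endomorphisms. -/
def prodTangent {φ : M → N} {x : M} {K : EndAt n (φ x)} (X : TangentSpace (𝓡 m) x)
    (v : TangentSpace (endModel n) (⟨φ x, K⟩ : EndBundle n N)) :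
    TangentSpace ((𝓡 m).prod (endModel n)) ((x, ⟨φ x, K⟩) : M × EndBundle n N) := (X, v)

/-- The component tangent to the bundle of endomorphisms. -/
def prodSnd (φ : M → N) (x : M) (K : EndAt n (φ x)) :
    TangentSpace ((𝓡 m).prod (endModel n)) ((x, ⟨φ x, K⟩) : M × EndBundle n N) →ₗ[ℝ]
      TangentSpace (endModel n) (⟨φ x, K⟩ : EndBundle n N) :=
  LinearMap.snd ℝ (Euc m) (Euc n × (Euc n →L[ℝ] Euc n))

lemma normalDProj_prodTangent {φ : M → N} {x : M} {K : EndAt n (φ x)} (X : TangentSpace (𝓡 m) x)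
    (v : TangentSpace (endModel n) (⟨φ x, K⟩ : EndBundle n N)) :
    normalDProj φ x K (prodTangent X v) = X := by
  have h := mfderiv_fst (I := 𝓡 m) (I' := endModel n) (x := ((x, ⟨φ x, K⟩) : M × EndBundle n N))
  exact congrArg (fun L : (Euc m × (Euc n × (Euc n →L[ℝ] Euc n))) →L[ℝ] Euc m ↦
    L ((X, v) : (Euc m × (Euc n × (Euc n →L[ℝ] Euc n))))) h

lemma mfderiv_alongSection {φ : M → N} {S : Π y : M, EndAt n (φ y)} {x : M}
    (hS : DiffEndAlong (m := m) φ S x) (X : TangentSpace (𝓡 m) x) :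
    mfderiv (𝓡 m) ((𝓡 m).prod (endModel n)) (alongSection φ S) x X =
      prodTangent X (mfderiv (𝓡 m) (endModel n) (fun y ↦ (⟨φ y, S y⟩ : EndBundle n N)) x X) := by
  have h := mfderiv_prodMk (I := 𝓡 m) (I' := 𝓡 m) (I'' := endModel n)
    (mdifferentiableAt_id (I := 𝓡 m) (x := x)) hS
  rw [mfderiv_id] at h
  exact congrArg (fun L : Euc m →L[ℝ] (Euc m × (Euc n × (Euc n →L[ℝ] Euc n))) ↦ L X) h

lemma normalVerticalLift_eq (φ : M → N) (x : M) (K A : EndAt n (φ x)) :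
    normalVerticalLift (m := m) φ x K A = prodTangent 0 (verticalLift (φ x) K A) := by
  have h := mfderiv_prodMk (I := 𝓘(ℝ, ℝ)) (I' := 𝓡 m) (I'' := endModel n)
    (mdifferentiableAt_const (c := x)) (mdifferentiableAt_vertical (φ x) K A 0)
  rw [mfderiv_const] at h
  exact congrArg (fun L : ℝ →L[ℝ] (Euc m × (Euc n × (Euc n →L[ℝ] Euc n))) ↦ L 1) h

end Product

/-! ### Smooth sections of endomorphisms along a map -/

section EndSections

variable {m n : ℕ}
  {M : Type*} [TopologicalSpace M] [ChartedSpace (Euc m) M]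
  {N : Type*} [TopologicalSpace N] [ChartedSpace (Euc n) N] [IsManifold (𝓡 n) ∞ N]

/-- `S` is a section along `φ` of the bundle of endomorphisms, which is smooth at `x`. -/
def SmoothEndAlong (φ : M → N) (S : Π x : M, EndAt n (φ x)) (x : M) : Prop :=
  ContMDiffAt (𝓡 m) (endModel n) ∞ (fun y ↦ (⟨φ y, S y⟩ : EndBundle n N)) x

namespace SmoothEndAlong

variable {φ : M → N} {S T : Π x : M, EndAt n (φ x)} {x : M}

lemma diff (hS : SmoothEndAlong (m := m) φ S x) : DiffEndAlong (m := m) φ S x :=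
  hS.mdifferentiableAt (by simp)

lemma base (hS : SmoothEndAlong (m := m) φ S x) : ContMDiffAt (𝓡 m) (𝓡 n) ∞ φ x :=
  ((contMDiffAt_totalSpace (IB := 𝓡 n)).1 hS).1

lemma coord (hS : SmoothEndAlong (m := m) φ S x) :
    ContMDiffAt (𝓡 m) 𝓘(ℝ, Euc n →L[ℝ] Euc n) ∞
      (fun y ↦ endCoord (φ x) (⟨φ y, S y⟩ : EndBundle n N)) x :=
  ((contMDiffAt_totalSpace (IB := 𝓡 n)).1 hS).2

lemma comp (hS : SmoothEndAlong (m := m) φ S x) (hT : SmoothEndAlong (m := m) φ T x) :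
    SmoothEndAlong (m := m) φ (fun y ↦ (S y).comp (T y)) x := by
  refine (contMDiffAt_totalSpace (IB := 𝓡 n)).2
    ⟨hS.base, (hS.coord.clm_comp hT.coord).congr_of_eventuallyEq ?_⟩
  filter_upwards [eventually_mem_frame hS.diff.base] with y hy
  ext w : 1
  refine (endCoord_eq hy ((S y).comp (T y)) w).trans ?_
  refine Eq.trans ?_ (congrArg (endCoord (φ x) ⟨φ y, S y⟩) (endCoord_eq hy (T y) w)).symm
  exact (endCoord_apply hy (S y) (T y ((coordEquiv hy).symm w))).symm

lemma eventually_endCoord_sub_smul (hS : SmoothEndAlong (m := m) φ S x) (f : M → ℝ) :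
    (fun y ↦ endCoord (φ x) (⟨φ y, S y - f y • T y⟩ : EndBundle n N)) =ᶠ[𝓝 x] fun y ↦
      endCoord (φ x) (⟨φ y, S y⟩ : EndBundle n N) -
        f y • endCoord (φ x) (⟨φ y, T y⟩ : EndBundle n N) := by
  filter_upwards [eventually_mem_frame hS.diff.base] with y hy
  ext w : 1
  simp only [endCoord_eq hy, _root_.sub_apply, _root_.smul_apply, map_sub, map_smul]

lemma sub_smul (hS : SmoothEndAlong (m := m) φ S x) (hT : SmoothEndAlong (m := m) φ T x)
    {f : M → ℝ} (hf : ContMDiffAt (𝓡 m) 𝓘(ℝ, ℝ) ∞ f x) :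
    SmoothEndAlong (m := m) φ (fun y ↦ S y - f y • T y) x :=
  (contMDiffAt_totalSpace (IB := 𝓡 n)).2
    ⟨hS.base, (hS.coord.sub (hf.smul hT.coord)).congr_of_eventuallyEq
      (hS.eventually_endCoord_sub_smul f)⟩

end SmoothEndAlong

lemma exists_smoothEndAlong {φ : M → N} {x : M} (hφ : ContMDiffAt (𝓡 m) (𝓡 n) ∞ φ x)
    (A : EndAt n (φ x)) : ∃ S : Π y : M, EndAt n (φ y), S x = A ∧ SmoothEndAlong (m := m) φ S x :=
  ⟨fun y ↦ FiberBundle.extend (E := fun z : N ↦ EndAt n z) (Euc n →L[ℝ] Euc n) A (φ y),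
    FiberBundle.extend_apply_self ..,
    (FiberBundle.contMDiffAt_extend (k := ∞) (V := fun z : N ↦ EndAt n z) (𝓡 n)
      (Euc n →L[ℝ] Euc n) A).comp x hφ⟩

/-- The tangent spaces at `J` and at `J'` are the same model space by definition. This and the two
lemmas below let one vector be read at either point when `J = J'` holds only propositionally. -/
lemma dProj_congr {z : N} {J J' : EndAt n z} (h : J = J')
    (v : TangentSpace (endModel n) (⟨z, J⟩ : EndBundle n N)) : dProj z J v = dProj z J' v := by
  subst h; rfl

lemma endCoordDeriv_congr {z : N} {J J' : EndAt n z} (h : J = J')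
    (v : TangentSpace (endModel n) (⟨z, J⟩ : EndBundle n N)) :
    endCoordDeriv z J v = endCoordDeriv z J' v := by
  subst h; rfl

lemma connector_congr (D : Connection n N) {z : N} {J J' : EndAt n z} (h : J = J')
    (v : TangentSpace (endModel n) (⟨z, J⟩ : EndBundle n N)) :
    connector D z J v = connector D z J' v := by
  subst h; rfl

/-- As `f` vanishes at `x` and has derivative `1` along `X`, subtracting `f T` keeps the value at
`x` and changes the velocity by a vertical vector only. This corrects a section so as to make it
parallel along `X`. -/
lemma mfderiv_sub_smul {φ : M → N} {S T : Π x : M, EndAt n (φ x)} {x : M}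
    (hS : SmoothEndAlong (m := m) φ S x) (hT : SmoothEndAlong (m := m) φ T x)
    {f : M → ℝ} (hf : ContMDiffAt (𝓡 m) 𝓘(ℝ, ℝ) ∞ f x) (hfx : f x = 0)
    (X : TangentSpace (𝓡 m) x) (hfX : mvfderiv (𝓡 m) f x X = 1) :
    (mfderiv (𝓡 m) (endModel n) (fun y ↦ (⟨φ y, S y - f y • T y⟩ : EndBundle n N)) x X :
      TangentSpace (endModel n) (⟨φ x, S x⟩ : EndBundle n N)) =
    mfderiv (𝓡 m) (endModel n) (fun y ↦ (⟨φ y, S y⟩ : EndBundle n N)) x X -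
      verticalLift (φ x) (S x) (T x) := by
  have hx : S x - f x • T x = S x := by rw [hfx]; simp
  have hd := (hS.sub_smul hT hf).diff
  refine endBundle_tangent_ext (J := S x) ?_ ?_
  · refine ((dProj_congr hx _).symm.trans (dProj_mfderiv hd X)).trans ?_
    rw [(dProj (φ x) (S x)).map_sub, dProj_mfderiv hS.diff, dProj_verticalLift, sub_zero]
  · refine ((endCoordDeriv_congr hx _).symm.trans (endCoordDeriv_mfderiv hd X)).trans ?_
    rw [(endCoordDeriv (φ x) (S x)).map_sub, endCoordDeriv_mfderiv hS.diff,
      endCoordDeriv_verticalLift, mvfderiv_congr (hS.eventually_endCoord_sub_smul f)]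
    have h1 := hf.mdifferentiableAt (by simp)
    have h2 : MDifferentiableAt (𝓡 m) 𝓘(ℝ, Euc n →L[ℝ] Euc n)
      (fun y ↦ f y • endCoord (φ x) (⟨φ y, T y⟩ : EndBundle n N)) x := h1.smul hT.diff.coord
    rw [mvfderiv_fun_sub hS.diff.coord h2, mvfderiv_fun_smul h1 hT.diff.coord, _root_.sub_apply,
      _root_.add_apply, ContinuousLinearMap.smulRight_apply, hfX, hfx, one_smul, _root_.smul_apply,
      zero_smul, zero_add]

end EndSections

/-! ### The eigenbundle on the normal twistor bundle -/

section NormalDistribution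

variable {m n : ℕ}
  {M : Type*} [TopologicalSpace M] [ChartedSpace (Euc m) M]
  {N : Type*} [TopologicalSpace N] [ChartedSpace (Euc n) N] [IsManifold (𝓡 n) ∞ N]
  {c : ConformalStructure n N} {φ : M → N} {q : Π x : M, EndAt n (φ x)} {x : M}

/-- The orthogonal projection onto the normal bundle is `-q²`, hence as smooth as `q`; project a
local extension of `U`. -/
lemma exists_smoothNormalFieldAt (hK : ∀ y, IsNormalComplexStructure (m := m) c φ y (q y))
    (hq : SmoothEndAlong (m := m) φ q x) {U : TangentSpace (𝓡 n) (φ x)}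
    (hU : U ∈ normalSpace (m := m) c φ x) :
    ∃ V : Π y : M, TangentSpace (𝓡 n) (φ y), SmoothNormalFieldAt (m := m) c φ V x ∧ V x = U := by
  refine ⟨fun y ↦ q y (q y (extendAlong φ (-U) y)), ⟨?_, .of_forall fun y ↦ (hK y).apply_mem _⟩, ?_⟩
  · have h1 := contMDiffAt_extendAlong hq.base (-U)
    have h2 : ContMDiffAt (𝓡 m) (𝓡 n).tangent ∞
        (fun y ↦ (⟨φ y, q y (extendAlong φ (-U) y)⟩ : TangentBundle (𝓡 n) N)) x :=
      ContMDiffAt.clm_bundle_apply (F₁ := Euc n) (F₂ := Euc n) hq h1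
    exact ContMDiffAt.clm_bundle_apply (F₁ := Euc n) (F₂ := Euc n) hq h2
  · change q x (q x (extendAlong φ (-U) x)) = U
    rw [extendAlong_self, map_neg, map_neg, (hK x).sq U hU, neg_neg]

/-- Any tangent vector `dq(X)` can be made horizontal by subtracting the vertical vector given by
the normal component of the covariant derivative of `q`. -/
lemma sub_normalVerticalLift_mem [IsManifold (𝓡 m) ∞ M] (D : Connection n N)
    (hK : ∀ y, IsNormalComplexStructure (m := m) c φ y (q y))
    (hq : SmoothEndAlong (m := m) φ q x) (X : TangentSpace (𝓡 m) x) {A : EndAt n (φ x)}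
    (hA : IsNormalEnd (m := m) c φ x A)
    (hAX : ∀ U ∈ normalSpace (m := m) c φ x, q x (endDerivative D φ q x X U) = q x (A U)) :
    mfderiv (𝓡 m) ((𝓡 m).prod (endModel n)) (alongSection φ q) x X -
      normalVerticalLift φ x (q x) A ∈ normalHorizontalSpace (m := m) c D φ x (q x) := by
  rw [mfderiv_alongSection hq.diff, normalVerticalLift_eq]
  -- No function has derivative `1` along `X = 0`. In that case `hAX` forces `A = 0`, and the vector
  -- is zero.
  by_cases hX : X = 0
  · subst hX
    have hA0 : A = 0 := by
      ext w
      obtain ⟨a, ha⟩ := (hK x).exists_eq_sub_sq w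
      have h1 := hAX _ ((hK x).apply_mem (q x w))
      rw [map_zero, _root_.zero_apply, map_zero] at h1
      have h2 := (hK x).sq _ (hA.normal _ ((hK x).apply_mem (q x w)))
      rw [← h1, map_zero] at h2
      rw [ha, map_sub, hA.tangent, neg_eq_zero.1 h2.symm]
      simp
    have hv : verticalLift (φ x) (q x) A = 0 := by
      refine endBundle_tangent_ext' D ?_ ?_
      · rw [dProj_verticalLift]
        exact ((dProj (φ x) (q x)).map_zero).symm
      · rw [connector_verticalLift, map_zero, hA0]
    have h0 : mfderiv (𝓡 m) (endModel n) (fun y ↦ (⟨φ y, q y⟩ : EndBundle n N)) x 0 =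
      verticalLift (φ x) (q x) A := (ContinuousLinearMap.map_zero _).trans hv.symm
    convert Submodule.zero_mem _ using 1
    exact (sub_eq_zero (G := Euc m × (Euc n × (Euc n →L[ℝ] Euc n)))).2 (Prod.ext rfl h0)
  obtain ⟨f, hf, hf0, hf1⟩ := exists_function_mvfderiv_eq_one x hX
  obtain ⟨T, hTx, hT⟩ := exists_smoothEndAlong hq.base A
  -- An extension `T` of `A` is compressed by the projection `-q²` on both sides, the two signs
  -- cancelling, so as to stay normal at every point while keeping the value `A` at `x`.
  let B : Π y : M, EndAt n (φ y) := fun y ↦ (q y).comp ((q y).comp ((T y).comp ((q y).comp (q y))))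
  have hB : SmoothEndAlong (m := m) φ B x := hq.comp (hq.comp (hT.comp (hq.comp hq)))
  have hBx : B x = A := by
    ext w
    obtain ⟨a, ha⟩ := (hK x).exists_eq_sub_sq w
    change q x (q x (T x (q x (q x w)))) = A w
    rw [hTx, (hK x).sq _ (hA.normal _ ((hK x).apply_mem _))]
    conv_rhs => rw [ha, map_sub, hA.tangent, zero_sub]
  have hBn : ∀ y, IsNormalEnd (m := m) c φ y (B y) := fun y ↦
    ⟨fun a ↦ by simp [B, (hK y).normalEnd.tangent], fun U _ ↦ (hK y).apply_mem _⟩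
  have hS := hq.sub_smul hB hf
  have hSx : q x - f x • B x = q x := by rw [hf0]; simp
  have hder := mfderiv_sub_smul hq hB hf hf0 X hf1
  rw [hBx] at hder
  have hEnd : endDerivative D φ (fun y ↦ q y - f y • B y) x X = endDerivative D φ q x X - A := by
    refine (connector_congr D hSx _).trans ((congrArg (connector D (φ x) (q x)) hder).trans ?_)
    rw [(connector D (φ x) (q x)).map_sub, connector_verticalLift]
    rfl
  -- The corrected section has derivative `∇_X q - A` along `X`. By `hAX`, the map `q x` kills its
  -- values on normal vectors, so these values are tangent to `M`.
  refine Submodule.subset_span ⟨fun y ↦ q y - f y • B y, X, hSx, ?_, .of_forall fun y ↦ ?_,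
    fun U hU ↦ ?_, ?_⟩
  · exact contMDiffAt_id.prodMk hS
  · refine ⟨fun a ↦ ?_, fun U hU ↦ ?_⟩
    · simp [(hK y).normalEnd.tangent, (hBn y).tangent]
    · exact sub_mem ((hK y).apply_mem U) (Submodule.smul_mem _ _ ((hBn y).normal U hU))
  · rw [pullbackConnection_clm_apply D hS.diff (hU.1.mdifferentiableAt (by simp)), hEnd, hSx,
      add_sub_cancel_right]
    refine (hK x).mem_range ?_
    rw [_root_.sub_apply, map_sub, hAX _ hU.2.self_of_nhds, sub_self]
  · refine Eq.trans ?_ (mfderiv_alongSection hS.diff X).symm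
    exact Prod.ext (sub_zero (G := Euc m) X) hder.symm

/-- The map which vanishes on horizontal vectors and which, up to the factor `K`, gives the normal
part of vertical vectors. -/
def normalConnector (D : Connection n N) (φ : M → N) (x : M) (K : EndAt n (φ x)) :
    TangentSpace ((𝓡 m).prod (endModel n)) ((x, ⟨φ x, K⟩) : M × EndBundle n N) →ₗ[ℝ]
      EndAt n (φ x) where
  toFun v := K.comp ((connector D (φ x) K (prodSnd φ x K v)).comp (K.comp K))
  map_add' v w := by
    rw [(prodSnd φ x K).map_add, (connector D (φ x) K).map_add]
    ext u; simp
  map_smul' a v := by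
    rw [(prodSnd φ x K).map_smul, (connector D (φ x) K).map_smul]
    ext u; simp

lemma normalConnector_apply (D : Connection n N) (K : EndAt n (φ x))
    (v : TangentSpace ((𝓡 m).prod (endModel n)) ((x, ⟨φ x, K⟩) : M × EndBundle n N))
    (w : TangentSpace (𝓡 n) (φ x)) :
    normalConnector D φ x K v w = K (connector D (φ x) K (prodSnd φ x K v) (K (K w))) := rfl

lemma normalConnector_mfderiv (D : Connection n N) (hq : DiffEndAlong (m := m) φ q x)
    (X : TangentSpace (𝓡 m) x) (w : TangentSpace (𝓡 n) (φ x)) :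
    normalConnector D φ x (q x)
        (mfderiv (𝓡 m) ((𝓡 m).prod (endModel n)) (alongSection φ q) x X) w =
      q x (endDerivative D φ q x X (q x (q x w))) := by
  refine (congrArg (fun v ↦ normalConnector D φ x (q x) v w) (mfderiv_alongSection hq X)).trans ?_
  rfl

/-- The condition defining horizontality says that `(∇_X S) U` is tangent to `M` for normal `U`, so
`K` kills it; every `K² w` is such a `U`. -/
lemma normalHorizontalSpace_le_ker (D : Connection n N)
    (hK : ∀ y, IsNormalComplexStructure (m := m) c φ y (q y))
    (hq : SmoothEndAlong (m := m) φ q x) :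
    normalHorizontalSpace (m := m) c D φ x (q x) ≤
      LinearMap.ker (normalConnector (m := m) D φ x (q x)) := by
  refine Submodule.span_le.2 ?_
  rintro v ⟨S, X, hSx, hS, -, hSU, rfl⟩
  have hSs : SmoothEndAlong (m := m) φ S x := hS.snd
  have hSd := hSs.diff
  -- The value `S x` replaces `q x` throughout, so that the vectors based at the two equal points
  -- have the same type.
  generalize hKdef : q x = K at *
  subst hSx
  change normalConnector D φ x (S x) _ = 0
  ext w
  rw [normalConnector_mfderiv D hSd]
  have hKx : IsNormalComplexStructure (m := m) c φ x (S x) := hKdef ▸ hK x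
  obtain ⟨V, hV, hVx⟩ := exists_smoothNormalFieldAt hK hq (hKx.apply_mem (S x w))
  obtain ⟨a, ha⟩ := hSU V hV
  rw [pullbackConnection_clm_apply D hSd (hV.1.mdifferentiableAt (by simp)), add_sub_cancel_right,
    hVx] at ha
  rw [← ha]
  exact hKx.normalEnd.tangent a

/-- Since `A` kills tangent vectors and `-K²` is the normal projection, `A K² = -A`; this gives the
sign. -/
lemma normalConnector_normalVerticalLift (D : Connection n N) {K A : EndAt n (φ x)}
    (hK : IsNormalComplexStructure (m := m) c φ x K) (hA : IsNormalEnd (m := m) c φ x A) :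
    normalConnector (m := m) D φ x K (normalVerticalLift φ x K A) = -(K.comp A) := by
  ext w
  have h : connector D (φ x) K (prodSnd φ x K (normalVerticalLift (m := m) φ x K A)) = A := by
    rw [normalVerticalLift_eq]
    exact connector_verticalLift D (φ x) K A
  obtain ⟨a, ha⟩ := hK.exists_eq_sub_sq w
  rw [normalConnector_apply, h]
  change _ = -K (A w)
  conv_rhs => rw [ha, map_sub, hA.tangent, zero_sub, map_neg, neg_neg]

/-- The normal connector kills horizontal vectors and sends `A - i K A` to `-K A - i A`, which lies
in the `(-i)`-eigenspace of `C ↦ -K C`. -/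
lemma of_mem_normalDistribution (D : Connection n N) (p : Π x : M, EndAt m x)
    (hK : ∀ y, IsNormalComplexStructure (m := m) c φ y (q y))
    (hq : SmoothEndAlong (m := m) φ q x)
    {a b : TangentSpace ((𝓡 m).prod (endModel n)) ((x, ⟨φ x, q x⟩) : M × EndBundle n N)}
    (h : cplx a b ∈ normalDistribution c D φ p x (q x)) :
    normalConnector D φ x (q x) b = -((q x).comp (normalConnector D φ x (q x) a)) := by
  have hle : normalDistribution c D φ p x (q x) ≤
      (antiholomorphicSpace (negComp (q x))).comap
        ((normalConnector (m := m) D φ x (q x)).baseChange ℂ) := by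
    refine sup_le (inf_le_left.trans ?_) (Submodule.span_le.2 ?_)
    · refine (baseChange_le_ker (normalHorizontalSpace_le_ker D hK hq)).trans ?_
      intro Z hZ
      rw [Submodule.mem_comap, LinearMap.mem_ker.1 hZ]
      exact Submodule.zero_mem _
    · rintro _ ⟨A, hA, rfl⟩
      change (normalConnector D φ x (q x)).baseChange ℂ _ ∈ antiholomorphicSpace (negComp (q x))
      have hKA : IsNormalEnd (m := m) c φ x ((q x).comp A) :=
        ⟨fun a ↦ by simp [hA.normalEnd.tangent], fun U _ ↦ (hK x).apply_mem _⟩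
      have hsq : ∀ w, q x (q x (A w)) = -A w := fun w ↦
        (hK x).sq _ (sq_mem_normalSpace hA.normalEnd w)
      rw [map_sub, LinearMap.baseChange_tmul, LinearMap.baseChange_tmul,
        normalConnector_normalVerticalLift D (hK x) hA.normalEnd,
        normalConnector_normalVerticalLift D (hK x) hKA, sub_eq_add_neg, ← TensorProduct.tmul_neg]
      refine cplx_mem_antiholomorphicSpace.2 ⟨?_, ?_⟩
      · ext w
        simp [negComp, hsq]
      · ext w
        simp [negComp, hsq]
  have := hle h
  rw [Submodule.mem_comap, baseChange_cplx, cplx_mem_antiholomorphicSpace] at this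
  exact this.1.symm

lemma normalVerticalLift_neg (D : Connection n N) (K A : EndAt n (φ x)) :
    normalVerticalLift (m := m) φ x K (-A) = -normalVerticalLift φ x K A := by
  have h : verticalLift (φ x) K (-A) = -verticalLift (φ x) K A := by
    refine endBundle_tangent_ext' D ?_ ?_
    · rw [(dProj (φ x) K).map_neg, dProj_verticalLift, dProj_verticalLift, neg_zero]
    · rw [(connector D (φ x) K).map_neg, connector_verticalLift, connector_verticalLift]
  rw [normalVerticalLift_eq, normalVerticalLift_eq, h]
  exact Prod.ext (neg_zero (G := Euc m)).symm rfl

lemma normalDProj_mfderiv_sub (hq : DiffEndAlong (m := m) φ q x) (X : TangentSpace (𝓡 m) x)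
    (A : EndAt n (φ x)) : normalDProj φ x (q x)
      (mfderiv (𝓡 m) ((𝓡 m).prod (endModel n)) (alongSection φ q) x X -
        normalVerticalLift φ x (q x) A) = X := by
  refine ((normalDProj φ x (q x)).map_sub _ _).trans ?_
  have h1 := congrArg (normalDProj φ x (q x)) (mfderiv_alongSection hq X)
  have h2 := congrArg (normalDProj φ x (q x)) (normalVerticalLift_eq (m := m) φ x (q x) A)
  rw [normalDProj_prodTangent] at h1 h2
  refine (congrArg₂ (· - ·) h1 h2).trans (sub_zero X)

/-- Here `A` and `-K A` are the normal parts of the derivatives of `q` along `X` and `J X`. Removing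
their vertical lifts leaves horizontal vectors over `X + i J X`, and what is removed is the
generator `A - i K A`. -/
lemma mem_normalDistribution_of [IsManifold (𝓡 m) ∞ M] (D : Connection n N) {p : Π x : M, EndAt m x}
    (hp : ∀ v, p x (p x v) = -v)
    (hK : ∀ y, IsNormalComplexStructure (m := m) c φ y (q y))
    (hq : SmoothEndAlong (m := m) φ q x) (X : TangentSpace (𝓡 m) x) {A : EndAt n (φ x)}
    (hA : IsNormalFibreTangent (m := m) c φ x (q x) A)
    (h1 : ∀ U ∈ normalSpace (m := m) c φ x, q x (endDerivative D φ q x X U) = q x (A U))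
    (h2 : ∀ U ∈ normalSpace (m := m) c φ x,
      q x (endDerivative D φ q x (p x X) U) = -q x (q x (A U))) :
    cplx (mfderiv (𝓡 m) ((𝓡 m).prod (endModel n)) (alongSection φ q) x X)
      (mfderiv (𝓡 m) ((𝓡 m).prod (endModel n)) (alongSection φ q) x (p x X)) ∈
      normalDistribution c D φ p x (q x) := by
  let a : TangentSpace ((𝓡 m).prod (endModel n)) ((x, ⟨φ x, q x⟩) : M × EndBundle n N) :=
    mfderiv (𝓡 m) ((𝓡 m).prod (endModel n)) (alongSection φ q) x X
  let b : TangentSpace ((𝓡 m).prod (endModel n)) ((x, ⟨φ x, q x⟩) : M × EndBundle n N) :=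
    mfderiv (𝓡 m) ((𝓡 m).prod (endModel n)) (alongSection φ q) x (p x X)
  have hKA : IsNormalEnd (m := m) c φ x (-(q x).comp A) :=
    ⟨fun a ↦ by simp [hA.normalEnd.tangent], fun U _ ↦ neg_mem ((hK x).apply_mem _)⟩
  have ha := sub_normalVerticalLift_mem D hK hq X hA.normalEnd h1
  have hb := sub_normalVerticalLift_mem D hK hq (p x X) hKA fun U hU ↦ by
    rw [h2 U hU, _root_.neg_apply, map_neg]; rfl
  have hZ : cplx a b = cplx (a - normalVerticalLift φ x (q x) A)
      (b - normalVerticalLift φ x (q x) (-(q x).comp A)) +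
      ((1 : ℂ) ⊗ₜ[ℝ] normalVerticalLift φ x (q x) A -
        Complex.I ⊗ₜ[ℝ] normalVerticalLift φ x (q x) ((q x).comp A)) := by
    rw [normalVerticalLift_neg D]
    simp only [cplx, TensorProduct.tmul_sub, TensorProduct.tmul_neg]
    abel
  change cplx a b ∈ _
  rw [hZ]
  refine Submodule.add_mem_sup ⟨cplx_mem_baseChange ha hb, ?_⟩ (Submodule.subset_span ⟨A, hA, rfl⟩)
  change (normalDProj φ x (q x)).toLinearMap.baseChange ℂ _ ∈ antiholomorphicSpace _
  rw [baseChange_cplx]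
  have e1 := normalDProj_mfderiv_sub hq.diff X A
  have e2 := normalDProj_mfderiv_sub hq.diff (p x X) (-(q x).comp A)
  refine cplx_mem_antiholomorphicSpace.2 ⟨(congrArg (p x) e1).trans e2.symm, ?_⟩
  exact (congrArg (p x) e2).trans ((hp X).trans (congrArg _ e1.symm))

end NormalDistribution

/-! ### Holomorphic sections and twistorial maps via covariant derivatives -/

section Holomorphic

variable {m n : ℕ}
  {M : Type*} [TopologicalSpace M] [ChartedSpace (Euc m) M]
  {N : Type*} [TopologicalSpace N] [ChartedSpace (Euc n) N] [IsManifold (𝓡 n) ∞ N]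

/-- The differential of a section along `φ` of the bundle of positive maximal isotropic spaces, in
terms of its covariant derivative. -/
lemma cplx_mfderiv_mem_distribution_iff (W : OrientedWeyl n N) {φ : M → N}
    {S : Π y : M, EndAt n (φ y)} {x : M} (hS : DiffEndAlong (m := m) φ S x)
    (hmem : ∀ y, (⟨φ y, S y⟩ : EndBundle n N) ∈ W.twistorBundle) (X X' : TangentSpace (𝓡 m) x) :
    cplx (mfderiv (𝓡 m) (endModel n) (fun y ↦ (⟨φ y, S y⟩ : EndBundle n N)) x X)
        (mfderiv (𝓡 m) (endModel n) (fun y ↦ (⟨φ y, S y⟩ : EndBundle n N)) x X') ∈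
        W.distribution (⟨φ x, S x⟩ : EndBundle n N) ↔
      differential φ x X' = S x (differential φ x X) ∧
        endDerivative W.D φ S x X' = -((S x).comp (endDerivative W.D φ S x X)) := by
  constructor
  · intro h
    have := of_cplx_mem_distribution W (hmem x).sq h
    rw [dProj_mfderiv hS, dProj_mfderiv hS] at this
    exact this
  · rintro ⟨h1, h2⟩
    refine cplx_mem_distribution_of W (hmem x).sq (isFibreTangent_endDerivative W hS hmem X) ?_ h2
    rw [dProj_mfderiv hS, dProj_mfderiv hS]
    exact h1

omit [IsManifold (𝓡 n) ∞ N] in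
lemma differential_id (x : N) (X : TangentSpace (𝓡 n) x) :
    differential (m := n) (n := n) (fun y : N ↦ y) x X = X :=
  congrArg (fun L : TangentSpace (𝓡 n) x →L[ℝ] TangentSpace (𝓡 n) x ↦ L X)
    (mfderiv_id (I := 𝓡 n) (x := x))

variable {W : OrientedWeyl n N} {p : Π x : N, EndAt n x}

lemma OrientedWeyl.IsSection.diffEndAlong (hp : W.IsSection p) (x : N) :
    DiffEndAlong (m := n) (fun y : N ↦ y) p x :=
  (hp.smooth x).mdifferentiableAt (by simp)

lemma OrientedWeyl.IsSection.sq (hp : W.IsSection p) (x : N) (v : TangentSpace (𝓡 n) x) :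
    p x (p x v) = -v :=
  (hp.mem x).sq v

lemma OrientedWeyl.IsSection.cplx_mem_distribution_iff (hp : W.IsSection p) (x : N)
    (X X' : TangentSpace (𝓡 n) x) :
    cplx (mfderiv (𝓡 n) (endModel n) (section_ p) x X)
        (mfderiv (𝓡 n) (endModel n) (section_ p) x X') ∈ W.distribution (section_ p x) ↔
      X' = p x X ∧ endDerivative W.D (fun y ↦ y) p x X' =
        -((p x).comp (endDerivative W.D (fun y ↦ y) p x X)) := by
  have h := cplx_mfderiv_mem_distribution_iff W (hp.diffEndAlong x) hp.mem X X'
  rw [differential_id, differential_id] at h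
  exact h

/-- When `J² = -1`, the `(-i)`-eigenspace consists exactly of the vectors `v + i J v` with `v` real.
-/
lemma map_antiholomorphicSpace_le_iff {V V' : Type*} [AddCommGroup V] [Module ℝ V]
    [AddCommGroup V'] [Module ℝ V'] {J : V →ₗ[ℝ] V} (hJ : ∀ v, J (J v) = -v) {L : V →ₗ[ℝ] V'}
    {F : Submodule ℂ (ℂ ⊗[ℝ] V')} :
    (antiholomorphicSpace J).map (L.baseChange ℂ) ≤ F ↔ ∀ v, cplx (L v) (L (J v)) ∈ F := by
  rw [Submodule.map_le_iff_le_comap]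
  constructor
  · intro h v
    rw [← baseChange_cplx]
    exact h (cplx_mem_antiholomorphicSpace_of_sq (hJ v))
  · intro h Z hZ
    obtain ⟨a, b, rfl⟩ := exists_eq_cplx Z
    rw [← (cplx_mem_antiholomorphicSpace.1 hZ).1, Submodule.mem_comap, baseChange_cplx]
    exact h a

lemma OrientedWeyl.IsSection.isHolomorphicSection_iff (hp : W.IsSection p) :
    W.IsHolomorphicSection p ↔ ∀ (x : N) (X : TangentSpace (𝓡 n) x),
      endDerivative W.D (fun y ↦ y) p x (p x X) =
        -((p x).comp (endDerivative W.D (fun y ↦ y) p x X)) := by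
  refine forall_congr' fun x ↦ ?_
  rw [map_antiholomorphicSpace_le_iff (hp.sq x)]
  refine forall_congr' fun X ↦ (hp.cplx_mem_distribution_iff x X (p x X)).trans ?_
  simp

variable {n' : ℕ} {N' : Type*} [TopologicalSpace N'] [ChartedSpace (Euc n') N']
  [IsManifold (𝓡 n') ∞ N'] {W' : OrientedWeyl n' N'}

/-- If `𝒥'` maps `dp(X)` to `dp(X')`, projecting gives `X' = J X`; so preservation of the tangent
bundle of `p(M)` is the holomorphicity of `p`. The vectors to be tested for `Φ` are then the `X + i
J X`, for which the projection condition is `hSφ`. -/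
lemma isTwistorial_iff (hp : W.IsSection p) {φ : N → N'} {S : Π x : N, EndAt n' (φ x)}
    (hS : ∀ x, DiffEndAlong (m := n) φ S x)
    (hSφ : ∀ (x : N) (X : TangentSpace (𝓡 n) x),
      S x (differential φ x X) = differential φ x (p x X))
    {Φ : Set.range (section_ p) → W'.twistorBundle}
    (hΦ : compSection Φ = fun x ↦ (⟨φ x, S x⟩ : EndBundle n' N')) :
    IsTwistorial W W' p Φ ↔ W.IsHolomorphicSection p ∧ ∀ (x : N) (X : TangentSpace (𝓡 n) x),
      endDerivative W'.D φ S x (p x X) = -((S x).comp (endDerivative W'.D φ S x X)) := by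
  have hmem : ∀ x, (⟨φ x, S x⟩ : EndBundle n' N') ∈ W'.twistorBundle := fun x ↦ by
    rw [← congrFun hΦ x]
    exact Subtype.property _
  rw [IsTwistorial, hΦ, hp.isHolomorphicSection_iff]
  constructor
  · rintro ⟨h1, h2⟩
    have h3 : ∀ (x : N) (X : TangentSpace (𝓡 n) x),
        cplx (mfderiv (𝓡 n) (endModel n) (section_ p) x X)
          (mfderiv (𝓡 n) (endModel n) (section_ p) x (p x X)) ∈ W.distribution (section_ p x) := by
      intro x X
      obtain ⟨_, ⟨X', rfl⟩, hX'⟩ := h1 x _ ⟨X, rfl⟩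
      have h := ((hp.cplx_mem_distribution_iff x X X').1 hX').1
      rw [← h]
      exact hX'
    refine ⟨fun x X ↦ ((hp.cplx_mem_distribution_iff x X _).1 (h3 x X)).2, fun x X ↦ ?_⟩
    have h4 := h2 x (cplx X (p x X)) (by rw [baseChange_cplx]; exact h3 x X)
    rw [baseChange_cplx] at h4
    exact ((cplx_mfderiv_mem_distribution_iff W' (hS x) hmem X (p x X)).1 h4).2
  · rintro ⟨h1, h2⟩
    refine ⟨?_, fun x Z hZ ↦ ?_⟩
    · rintro x _ ⟨X, rfl⟩
      exact ⟨_, ⟨p x X, rfl⟩, (hp.cplx_mem_distribution_iff x X _).2 ⟨rfl, h1 x X⟩⟩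
    · obtain ⟨X, X', rfl⟩ := exists_eq_cplx Z
      rw [baseChange_cplx] at hZ ⊢
      obtain ⟨rfl, -⟩ := (hp.cplx_mem_distribution_iff x X X').1 hZ
      exact (cplx_mfderiv_mem_distribution_iff W' (hS x) hmem X (p x X)).2
        ⟨(hSφ x X).symm, h2 x X⟩

end Holomorphic

/-! ### Tangent vectors: the condition on `S` and the `(1,1)`-geodesic condition -/

section Sum

variable {m n : ℕ}
  {M : Type*} [TopologicalSpace M] [ChartedSpace (Euc m) M] [IsManifold (𝓡 m) ∞ M]
  {N : Type*} [TopologicalSpace N] [ChartedSpace (Euc n) N] [IsManifold (𝓡 n) ∞ N]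

/-- The covariant derivative of `S`, where `S ∘ dφ = dφ ∘ p`, on the vectors tangent to `φ`. -/
lemma endDerivative_differential (DM : Connection m M) (DN : Connection n N) {φ : M → N}
    (hφ : ContMDiff (𝓡 m) (𝓡 n) ∞ φ) {p : Π x : M, EndAt m x} {S : Π x : M, EndAt n (φ x)} {x : M}
    (hp : DiffEndAlong (m := m) (fun y : M ↦ y) p x) (hS : DiffEndAlong (m := m) φ S x)
    (hSφ : ∀ (x : M) (X : TangentSpace (𝓡 m) x),
      S x (differential φ x X) = differential φ x (p x X)) (X Y : TangentSpace (𝓡 m) x) :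
    endDerivative DN φ S x X (differential φ x Y) =
      sff DM DN φ x X (p x Y) - S x (sff DM DN φ x X Y) +
        differential φ x (endDerivative DM (fun y ↦ y) p x X Y) := by
  have hYs := FiberBundle.contMDiffAt_extend (k := ∞) (𝓡 m) (Euc m) Y
  have hY : DiffAlong (m := m) (fun y : M ↦ y) (FiberBundle.extend (Euc m) Y) x :=
    FiberBundle.mdifferentiableAt_extend (𝓡 m) (Euc m) Y
  have hdY : DiffAlong (m := m) φ (fun y ↦ differential φ y (FiberBundle.extend (Euc m) Y y)) x :=
    (contMDiffAt_differential_apply hφ hYs).mdifferentiableAt (by simp)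
  -- Differentiate `S(dφ Y) = dφ(J Y)`, with the Leibniz rule on the left and the second fundamental
  -- form on the right.
  have h1 := pullbackConnection_clm_apply DN hS hdY X
  simp only [hSφ] at h1
  rw [pullbackConnection_differential DM DN hφ hY,
    pullbackConnection_differential DM DN hφ (hp.apply hY), endDerivative_id_apply DM hp hY,
    map_add, map_add, hSφ, FiberBundle.extend_apply_self] at h1
  rw [eq_comm, ← sub_eq_iff_eq_add] at h1
  rw [← h1]
  abel

/-- On the vectors tangent to `φ`, the holomorphicity condition means that `φ` is
`(1,1)`-geodesic. -/
lemma isOneOneGeodesic_iff {DM : Connection m M} {DN : Connection n N} (hDM : DM.torsion = 0)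
    (hDN : DN.torsion = 0) {φ : M → N} (hφ : ContMDiff (𝓡 m) (𝓡 n) ∞ φ)
    {p : Π x : M, EndAt m x} {S : Π x : M, EndAt n (φ x)}
    (hp : ∀ x, DiffEndAlong (m := m) (fun y : M ↦ y) p x)
    (hp2 : ∀ (x : M) (X : TangentSpace (𝓡 m) x), p x (p x X) = -X)
    (hphol : ∀ (x : M) (X : TangentSpace (𝓡 m) x), endDerivative DM (fun y ↦ y) p x (p x X) =
        -((p x).comp (endDerivative DM (fun y ↦ y) p x X)))
    (hS : ∀ x, DiffEndAlong (m := m) φ S x)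
    (hS2 : ∀ (x : M) (v : TangentSpace (𝓡 n) (φ x)), S x (S x v) = -v)
    (hSφ : ∀ (x : M) (X : TangentSpace (𝓡 m) x),
      S x (differential φ x X) = differential φ x (p x X)) :
    IsOneOneGeodesic DM DN φ p ↔ ∀ (x : M) (X Y : TangentSpace (𝓡 m) x),
      endDerivative DN φ S x (p x X) (differential φ x Y) =
        -S x (endDerivative DN φ S x X (differential φ x Y)) := by
  simp only [IsOneOneGeodesic, secondFundamentalForm_eq DM DN hφ]
  refine forall_congr' fun x ↦ ?_
  have hsym := sff_symm hDM hDN hφ x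
  -- The terms `dφ((∇J) Y)` cancel because `p` is holomorphic; only the second fundamental form
  -- remains.
  have key : ∀ X Y, (endDerivative DN φ S x (p x X) (differential φ x Y) =
        -S x (endDerivative DN φ S x X (differential φ x Y))) ↔
      sff DM DN φ x X Y + sff DM DN φ x (p x X) (p x Y) =
        S x (sff DM DN φ x (p x X) Y - sff DM DN φ x X (p x Y)) := by
    intro X Y
    rw [endDerivative_differential DM DN hφ (hp x) (hS x) hSφ,
      endDerivative_differential DM DN hφ (hp x) (hS x) hSφ, hphol]
    simp only [map_add, map_sub, map_neg, hS2, hSφ, _root_.neg_apply,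
      ContinuousLinearMap.comp_apply]
    constructor
    · intro h
      rw [← sub_eq_zero] at h ⊢
      rw [← h]
      abel
    · intro h
      rw [← sub_eq_zero] at h ⊢
      rw [← h]
      abel
  simp only [key]
  constructor
  -- Replacing `X` by `J X` in the `(1,1)`-condition shows that the right side of `key` vanishes as
  -- well.
  · intro h X Y
    have h1 := h (p x X) Y
    rw [hp2, sff_neg_left, ← sub_eq_add_neg] at h1
    rw [h, h1, map_zero]
  -- Exchanging `X` and `Y` fixes the left side of `key` and changes the sign of the right side, so
  -- twice the right side is zero.
  · intro h X Y
    have h1 := h X Y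
    have h2 := h Y X
    rw [hsym Y X, hsym (p x Y) (p x X), h1, hsym (p x Y) X, hsym Y (p x X), ← neg_sub, map_neg] at h2
    rw [h1, ← neg_sub, map_neg, neg_eq_zero]
    refine (smul_eq_zero.1 ((two_smul ℝ _).trans ?_)).resolve_left two_ne_zero
    exact (congrArg (_ + ·) h2.symm).trans (add_neg_cancel _)

end Sum

/-! ### Normal vectors: the condition on `S` and the holomorphicity of `q` -/

section NormalPart

variable {m n : ℕ}
  {M : Type*} [TopologicalSpace M] [ChartedSpace (Euc m) M]
  {N : Type*} [TopologicalSpace N] [ChartedSpace (Euc n) N] [IsManifold (𝓡 n) ∞ N]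
  {φ : M → N} {J : Π x : M, EndAt m x} {q S : Π x : M, EndAt n (φ x)} {x : M}

/-- `S` is the sum of `J`, on the vectors tangent to `φ`, and of `K`, on the normal vectors. -/
structure IsSum (c : ConformalStructure n N) (φ : M → N) (x : M) (J : EndAt m x)
    (K S : EndAt n (φ x)) : Prop where
  complexStructure : IsNormalComplexStructure (m := m) c φ x K
  tangent : ∀ X : TangentSpace (𝓡 m) x, S (differential φ x X) = differential φ x (J X)
  normal : ∀ U ∈ normalSpace (m := m) c φ x, S U = K U

namespace IsSum

variable {c : ConformalStructure n N} {J : EndAt m x} {K S : EndAt n (φ x)}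

/-- The normal component of `S w` depends only on the normal component of `w`. -/
lemma normal_comp (h : IsSum c φ x J K S) (w : TangentSpace (𝓡 n) (φ x)) :
    K (S w) = K (K w) := by
  obtain ⟨a, ha⟩ := h.complexStructure.exists_eq_sub_sq w
  have h1 := congrArg S ha
  rw [map_sub, h.tangent, h.normal _ (h.complexStructure.apply_mem _), h.complexStructure.cube,
    sub_neg_eq_add] at h1
  rw [h1, map_add, h.complexStructure.normalEnd.tangent, zero_add]

/-- The endomorphism is the compression of `A` by the normal projection `-K²` on both sides.
Compression preserves skewness, and it preserves anticommutation because `S` agrees with `K` on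
normal vectors. -/
lemma isNormalFibreTangent {W : OrientedWeyl n N} (h : IsSum W.c φ x J K S) {A : EndAt n (φ x)}
    (hA : W.IsFibreTangent (φ x) S A) :
    IsNormalFibreTangent (m := m) W.c φ x K (K.comp (K.comp (A.comp (K.comp K)))) := by
  have hK := h.complexStructure
  have hform : ∀ U ∈ normalSpace (m := m) W.c φ x, ∀ V ∈ normalSpace (m := m) W.c φ x,
      W.c.form (φ x) (K (K (A (K (K U))))) V = W.c.form (φ x) (A U) V := fun U hU V hV ↦ by
    rw [hK.form_sq_left _ hV, hK.sq U hU, map_neg, map_neg, LinearMap.neg_apply, neg_neg]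
  refine ⟨⟨fun a ↦ by simp [hK.normalEnd.tangent], fun U _ ↦ hK.apply_mem _⟩, fun U hU ↦ ?_,
    fun U hU V hV ↦ ?_⟩
  · change K (K (A (K (K (K U))))) = -K (K (K (A (K (K U)))))
    have e : A (K (K (K U))) = S (A U) := by
      rw [hK.cube, map_neg, ← h.normal U hU, hA.1, neg_neg]
    rw [e, h.normal_comp, hK.sq U hU]
    simp only [map_neg, neg_neg]
  · refine (hform U hU V hV).trans ?_
    rw [hA.2, form_symm W.c _ U, ← hform V hV U hU, form_symm W.c _ U]
    rfl

/-- Given that it holds on the vectors tangent to `φ`, the holomorphicity condition has to be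
verified only for the normal components of the values on normal vectors. -/
lemma eq_neg_comp {W : OrientedWeyl n N} (h : IsSum W.c φ x J K S)
    (hS : ∀ v, S (S v) = -v) (hSo : ∀ v w, W.c.form (φ x) (S v) (S w) = W.c.form (φ x) v w)
    {A A' : EndAt n (φ x)} (hA : W.IsFibreTangent (φ x) S A) (hA' : W.IsFibreTangent (φ x) S A')
    (hT : ∀ X : TangentSpace (𝓡 m) x, A' (differential φ x X) = -S (A (differential φ x X)))
    (hN : ∀ U ∈ normalSpace (m := m) W.c φ x, K (A' U) = -K (K (A U))) : A' = -(S.comp A) := by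
  have hK := h.complexStructure
  ext w
  obtain ⟨a, U, hU, rfl⟩ := exists_add_normal (m := m) W.c φ x w
  change A' _ = -S (A _)
  rw [map_add, map_add, map_add, neg_add, hT]
  congr 1
  -- Both `A'` and `S A` are skew, the latter because `A` anticommutes with `S`. Moving them onto
  -- `dφ(Y)` reduces the tangential component to `hT`.
  have hL : A' U + S (A U) ∈ normalSpace (m := m) W.c φ x := by
    intro Y
    have h1 : W.c.form (φ x) (S (A U)) (differential φ x Y) =
        -W.c.form (φ x) U (S (A (differential φ x Y))) := by
      have h2 := hSo (S (A U)) (differential φ x Y)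
      rw [hS, map_neg, LinearMap.neg_apply, hA.2, hA.1, map_neg] at h2
      linarith
    rw [map_add, LinearMap.add_apply, hA'.2, hT, h1, map_neg]
    ring
  have h3 : K (A' U + S (A U)) = 0 := by
    rw [map_add, hN U hU, h.normal_comp, neg_add_cancel]
  have h4 := hK.sq _ hL
  rw [h3, map_zero] at h4
  exact eq_neg_of_add_eq_zero_left (neg_eq_zero.1 h4.symm)

end IsSum

variable {W : OrientedWeyl n N}

/-- The normal components of the covariant derivatives of `q` and of `S`, on normal vectors. -/
lemma normal_endDerivative (D : Connection n N) {c : ConformalStructure n N}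
    (h : ∀ y, IsSum c φ y (J y) (q y) (S y)) (hq : SmoothEndAlong (m := m) φ q x)
    (hS : SmoothEndAlong (m := m) φ S x) (X : TangentSpace (𝓡 m) x)
    {U : TangentSpace (𝓡 n) (φ x)} (hU : U ∈ normalSpace (m := m) c φ x) :
    q x (endDerivative D φ q x X U) = q x (endDerivative D φ S x X U) := by
  obtain ⟨V, hV, rfl⟩ := exists_smoothNormalFieldAt (fun y ↦ (h y).complexStructure) hq hU
  have hVd : DiffAlong (m := m) φ V x := hV.1.mdifferentiableAt (by simp)
  -- Near `x` the field `V` is normal, so `q V = S V`. In the Leibniz expansions of both sides, the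
  -- terms with the derivative of `V` have the same normal component by `normal_comp`.
  have h1 : pullbackConnection (m := m) D φ (fun y ↦ q y (V y)) x =
      pullbackConnection (m := m) D φ (fun y ↦ S y (V y)) x :=
    pullbackConnection_congr D (hV.2.mono fun y hy ↦ ((h y).normal _ hy).symm)
  have h2 := congrArg (fun L : TangentSpace (𝓡 m) x →L[ℝ] TangentSpace (𝓡 n) (φ x) ↦ q x (L X)) h1
  simp only [pullbackConnection_clm_apply D hq.diff hVd, pullbackConnection_clm_apply D hS.diff hVd,
    map_add, (h x).normal_comp] at h2
  exact add_right_cancel h2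

/-- The derivative of `q` is replaced by that of `S`, which has the same normal component, so the
condition becomes the normal part of `∇_{JX} S = -S ∇_X S`. -/
lemma isHolomorphicNormalSection_iff [IsManifold (𝓡 m) ∞ M]
    (hJ : ∀ (y : M) (X : TangentSpace (𝓡 m) y), J y (J y X) = -X)
    (h : ∀ y, IsSum W.c φ y (J y) (q y) (S y)) (hq : ∀ y, SmoothEndAlong (m := m) φ q y)
    (hS : ∀ y, SmoothEndAlong (m := m) φ S y)
    (hmem : ∀ y, (⟨φ y, S y⟩ : EndBundle n N) ∈ W.twistorBundle) :
    IsHolomorphicNormalSection W.c W.D φ J q ↔ ∀ (y : M) (X : TangentSpace (𝓡 m) y),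
      ∀ U ∈ normalSpace (m := m) W.c φ y,
        q y (endDerivative W.D φ S y (J y X) U) = -q y (q y (endDerivative W.D φ S y X U)) := by
  have hK := fun y ↦ (h y).complexStructure
  refine forall_congr' fun y ↦ ?_
  refine (map_antiholomorphicSpace_le_iff (hJ y)).trans
    (forall_congr' fun X ↦ ⟨fun hX U hU ↦ ?_, fun hX ↦ ?_⟩)
  · have h1 := congrArg (fun A : EndAt n (φ y) ↦ A U)
      (of_mem_normalDistribution W.D J hK (hq y) hX)
    change normalConnector W.D φ y (q y) (mfderiv (𝓡 m) ((𝓡 m).prod (endModel n))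
        (alongSection φ q) y (J y X)) U = -q y (normalConnector W.D φ y (q y)
          (mfderiv (𝓡 m) ((𝓡 m).prod (endModel n)) (alongSection φ q) y X) U) at h1
    rw [normalConnector_mfderiv W.D (hq y).diff, normalConnector_mfderiv W.D (hq y).diff,
      (hK y).sq U hU] at h1
    simp only [map_neg, neg_neg, normal_endDerivative W.D h (hq y) (hS y) _ hU] at h1
    rw [← h1, neg_neg]
  -- The vertical part is the normal compression of `∇_X S`, tangent to the fibre because `∇_X S`
  -- is.
  · refine mem_normalDistribution_of W.D (hJ y) hK (hq y) X
      ((h y).isNormalFibreTangent (isFibreTangent_endDerivative W (hS y).diff hmem X))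
      (fun U hU ↦ ?_) fun U hU ↦ ?_
    · rw [normal_endDerivative W.D h (hq y) (hS y) _ hU]
      change _ = q y (q y (q y (endDerivative W.D φ S y X (q y (q y U)))))
      rw [(hK y).cube, (hK y).sq U hU, map_neg, map_neg, neg_neg]
    · rw [normal_endDerivative W.D h (hq y) (hS y) _ hU, hX U hU]
      change _ = -q y (q y (q y (q y (endDerivative W.D φ S y X (q y (q y U))))))
      rw [(hK y).cube, (hK y).sq U hU, map_neg, map_neg, map_neg, neg_neg]

end NormalPart

end Twistor

end

/-! ### The equivalence -/

theorem proposition3p4 {m n : ℕ} (hm : Even m) (hn : Even n)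
    {M : Type*} [TopologicalSpace M] [T2Space M] [SigmaCompactSpace M]
    [ChartedSpace (Euc m) M] [IsManifold (𝓡 m) ∞ M]
    {N : Type*} [TopologicalSpace N] [T2Space N] [SigmaCompactSpace N]
    [ChartedSpace (Euc n) N] [IsManifold (𝓡 n) ∞ N]
    (WM : OrientedWeyl m M) (WN : OrientedWeyl n N)
    (φ : M → N) (hφ : IsInjectiveImmersion (m := m) (n := n) φ)
    (p : Π x : M, EndAt m x) (hp : WM.IsSection p) (hpN : IsIsotropicAlong WN.c φ p)
    (q : Π x : M, EndAt n (φ x)) (hq : IsNormalSection WM WN φ q)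
    (Φ : Set.range (section_ p) → WN.twistorBundle)
    (hΦ : ContMDiff (𝓡 m) (endModel n) ∞ (compSection Φ))
    (hΦpq : IsGivenBy φ p q Φ) :
    IsTwistorial WM WN p Φ ↔
      IsOneOneGeodesic WM.D WN.D φ p ∧
      WM.IsHolomorphicSection p ∧
      IsHolomorphicNormalSection WN.c WN.D φ p q := by
  choose S hS hSanti using hΦpq
  have hΦS : compSection Φ = fun x ↦ (⟨φ x, S x⟩ : EndBundle n N) := funext hS
  have hmem : ∀ x, (⟨φ x, S x⟩ : EndBundle n N) ∈ WN.twistorBundle := fun x ↦ by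
    rw [← hS x]
    exact Subtype.property _
  have hSs : ∀ x, SmoothEndAlong (m := m) φ S x := fun x ↦ by
    rw [hΦS] at hΦ
    exact hΦ x
  have hqs : ∀ x, SmoothEndAlong (m := m) φ q x := fun x ↦ (hq.smooth x).snd
  have hsum : ∀ x, IsSum WN.c φ x (p x) (q x) (S x) := fun x ↦
    ⟨⟨(hq.mem x).normalEnd, (hq.mem x).sq⟩, sum_apply_differential (hSanti x) (hp.sq x),
      fun U hU ↦ sum_apply_of_sq (hSanti x) ((hq.mem x).sq U hU)⟩
  have hpd := hp.diffEndAlong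
  have hSφ := fun x ↦ (hsum x).tangent
  -- Holomorphicity of `p` is common to both sides. It is factored out because the comparison on
  -- tangent vectors depends on it.
  rw [isTwistorial_iff hp (fun x ↦ (hSs x).diff) hSφ hΦS, and_left_comm]
  refine and_congr_right fun hphol ↦ ?_
  rw [isOneOneGeodesic_iff WM.isWeyl.torsion_eq_zero WN.isWeyl.torsion_eq_zero hφ.smooth hpd hp.sq
    (hp.isHolomorphicSection_iff.1 hphol) (fun x ↦ (hSs x).diff) (fun x ↦ (hmem x).sq) hSφ,
    isHolomorphicNormalSection_iff hp.sq hsum hqs hSs hmem]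
  constructor
  -- The equality of endomorphisms is evaluated on tangent vectors, and on normal vectors after
  -- applying `q`, where `q S = q²`.
  · refine fun h ↦ ⟨fun x X Y ↦ by rw [h]; rfl, fun x X U _ ↦ ?_⟩
    rw [h]
    change q x (-S x _) = _
    rw [map_neg, (hsum x).normal_comp]
    rfl
  · rintro ⟨hT, hN⟩ x X
    exact (hsum x).eq_neg_comp (hmem x).sq (hmem x).orthogonal
      (isFibreTangent_endDerivative WN (hSs x).diff hmem X)
      (isFibreTangent_endDerivative WN (hSs x).diff hmem (p x X)) (hT x X) (hN x X)
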